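/- **Model.** For each sample size $n$ consider $\mathbf y=\mathbf X\boldsymbol\beta^*+\boldsymbol\varepsilon$ with $\boldsymbol\varepsilon\sim\mathcal N(\mathbf 0,\sigma^2\mathbb I_n)$, $\sigma>0$ fixed, where $\mathbf X=[\mathbf 1,\mathbf X_0,\mathbf X_1,\dots,\mathbf X_l]$ has an intercept column, $p_0$ columns $\mathbf X_0$ of continuous regressors, and for each factor $k=1,\dots,l$ with levels $1,\dots,p_k$ the zero-one dummy coding $\mathbf X_k$ with reference level $1$. The parameter vector $\boldsymbol\beta=(\beta_{00},(\beta_{j0})_{1\le j\le p_0},(\beta_{jk})_{2\le j\le p_k,1\le k\le l})$ has length $p=p_n=1+p_0+\sum_{k=1}^l(p_k-1)$; put $\beta_{1k}=0$ for $k\ge1$. The numbers $p_0,l,p_k$, the matrix $\mathbf X$ and $\boldsymbol\beta^*$ may depend on $n$, and $\mathbf X$ has rank $p_n$ for all large $n$. **Feasible models.** A feasible model $M=(P_0,P_1,\dots,P_l)$ consists of a subset $P_0$ of the continuous regressors and a partition $P_k$ of the levels of each factor $k$. Its parameter space $\mathcal L_M$ is the set of $\boldsymbol\beta\in\mathbb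 R^p$ with $\beta_{j0}=0$ for $1\le j\le p_0$, $j\notin P_0$, and $\beta_{ik}=\beta_{jk}$ whenever $i,j$ lie in the same cluster of $P_k$. Its size is $|M|=\dim\mathcal L_M$, and $F$ is the full model, $\mathcal L_F=\mathbb R^p$. Let $\mathbf A^1_M$ be the $p\times|M|$ zero-one matrix whose columns are the indicators of the intercept, of each $j\in P_0$, and of each cluster not containing the reference level; its columns form a basis of $\mathcal L_M$. Put $\mathbf Z_M=\mathbf X\mathbf A^1_M$, $\widehat{\boldsymbol\beta}_M=\mathbf A^1_M(\mathbf Z_M^T\mathbf Z_M)^{-1}\mathbf Z_M^T\mathbf y$, $\mathbf H_M=\mathbf Z_M(\mathbf Z_M^T\mathbf Z_M)^{-1}\mathbf Z_M^T$, $RSS_M=\|\mathbf y-\mathbf X\widehat{\boldsymbol\beta}_M\|^2$, $GIC_M=n\log RSS_M+r_n|M|$ and $\Delta_M=\boldsymbol\beta^{*T}\mathbf X^T(\mathbb I-\mathbf H_M)\mathbf X\boldsymbol\beta^*$. Let $T=T_n$ be the feasible model of minimal size with $\boldsymbol\beta^*\in\mathcal L_T$, and let $\Delta=\min\{\Delta_M:\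 |M|=|F|-1,\ \mathcal L_T\not\subseteq\mathcal L_M\}$ (with $\Delta=\infty$ if there is no such $M$). **Procedure (DMR).** Let $\widehat{\boldsymbol\beta}=(\mathbf X^T\mathbf X)^{-1}\mathbf X^T\mathbf y$, $\widehat\sigma^2=\|\mathbf y-\mathbf X\widehat{\boldsymbol\beta}\|^2/(n-p)$, and for a constraint $\mathbf a^T\boldsymbol\beta=0$ let $t^2(\mathbf a)=(\mathbf a^T\widehat{\boldsymbol\beta})^2/(\widehat\sigma^2\,\mathbf a^T(\mathbf X^T\mathbf X)^{-1}\mathbf a)$. 1. For each factor $k$ cluster its levels agglomeratively. Start from singletons, with distance between $\{i\}$ and $\{j\}$ equal to $t^2$ of the constraint $\beta_{ik}=\beta_{jk}$. In each step merge two clusters $C,C'$ at minimal distance; this distance is the cutting height of the step, and the step gives the constraint $\beta_{ik}=\beta_{jk}$ with $i=\min C$, $j=\min C'$. The distance from $C\cup C'$ to any other cluster $E$ is $b\min\{d(C,E),d(C',E)\}+(1-b)\max\{d(C,E),d(C',E)\}$ with $b\in[0,1]$, where $b$ may be constant or vary from one update to another. 2. Sort the $p-1$ constraints, namely $\beta_{j0}=0$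 with height $t^2$ ($1\le j\le p_0$) and those from the merging steps with their cutting heights, by increasing height; let $M_m$ be the feasible model defined by the first $m$ of them, $0\le m\le p-1$. 3. $\widehat T$ is a minimizer of $GIC_{M_m}$ over $0\le m\le p-1$. Ties are broken in any (measurable) way. **Theorem.** Assume that the true model is fixed or, more generally, that $\sup_n|T_n|<\infty$, and that $p_n=o(r_n)$ and $r_n=o(\min(n,\Delta))$, with $r_n>0$. Then: (a) $\lim_{n\to\infty}\mathbb P(\widehat T=T)=1$. (b) If in addition $p_0$, $l$, all $p_k$ (hence $p$) and $T$ do not depend on $n$, and $\frac1n\mathbf X^T\mathbf X\to\boldsymbol\Sigma$ with $\boldsymbol\Sigma$ positive definite, then $$\sqrt n\,(\widehat{\boldsymbol\beta}_{\widehat T}-\boldsymbol\beta^*)\xrightarrow{d}\mathcal N(\mathbf 0,\sigma^2\boldsymbol\Sigma_T),\qquad \boldsymbol\Sigma_T=\mathbf A^1_T(\mathbf A_T^{1T}\boldsymbol\Sigma\mathbf A^1_T)^{-1}\mathbf A_T^{1T}.$$ -/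

import Mathlib

open MeasureTheory ProbabilityTheory Filter Topology
open scoped Matrix ENNReal NNReal

noncomputable section

namespace DMR

/-! ### The linear model with continuous regressors and factors -/

/-- Numbers of continuous regressors, of factors, and of non-reference levels of each factor.
Factor `k` has `extraLevels k + 1` levels, level `0` being the reference level. -/
structure Layout where
  numCont : ℕ
  numFactors : ℕ
  extraLevels : Fin numFactors → ℕ

namespace Layout

variable (L : Layout)

/-- The levels of factor `k`; the reference level is `0`. -/
abbrev Level (k : Fin L.numFactors) : Type := Fin (L.extraLevels k + 1)

/-- The elementary constraints produced along the procedure: one for each continuous regressor,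
one for each merging step of each factor. -/
abbrev Step : Type := Fin L.numCont ⊕ (Σ k : Fin L.numFactors, Fin (L.extraLevels k))

/-- Index set of the parameter vector: intercept, coefficients of the continuous regressors,
coefficients of the non-reference levels of the factors. -/
abbrev Param : Type :=
  Unit ⊕ (Fin L.numCont ⊕ (Σ k : Fin L.numFactors, Fin (L.extraLevels k)))

/-- The number `p` of parameters. -/
def numParams : ℕ := Fintype.card L.Param

/-- The vector picking the coefficient of a continuous regressor. -/
def contVec (j : Fin L.numCont) : L.Param → ℝ := Pi.single (Sum.inr (Sum.inl j)) 1

/-- The vector picking the coefficient of a level of factor `k`; the coefficient of the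
reference level is `0`. -/
def levelVec (k : Fin L.numFactors) : L.Level k → L.Param → ℝ :=
  Fin.cases 0 (fun j => Pi.single (Sum.inr (Sum.inr ⟨k, j⟩)) 1)

end Layout

/-- `n` observations: values of the continuous regressors and levels of the factors. -/
structure Data (L : Layout) (n : ℕ) where
  cont : Fin n → Fin L.numCont → ℝ
  level : Fin n → (k : Fin L.numFactors) → L.Level k

/-- The model matrix `[1, X₀, X₁, …, X_l]`, where `X₁, …, X_l` are the zero-one dummy codings
of the factors. -/
def Data.X {L : Layout} {n : ℕ} (D : Data L n) : Matrix (Fin n) L.Param ℝ :=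
  Matrix.of fun i => Sum.elim (fun _ => 1)
    (Sum.elim (D.cont i) (fun q => if D.level i q.1 = q.2.succ then 1 else 0))

/-! ### Feasible models -/

/-- A feasible model: the set of continuous regressors that are kept and a partition of the
levels of each factor. -/
@[ext]
structure Model (L : Layout) where
  cont : Finset (Fin L.numCont)
  part : (k : Fin L.numFactors) → Finpartition (Finset.univ : Finset (L.Level k))

namespace Model

variable {L : Layout} (M : Model L)

/-- The linear space of parameters of the model: the coefficients of the deleted continuous
regressors vanish, and levels in the same cluster have equal coefficients. -/
def space : Submodule ℝ (L.Param → ℝ) where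
  carrier := {β | (∀ j, j ∉ M.cont → L.contVec j ⬝ᵥ β = 0) ∧
    ∀ k, ∀ C ∈ (M.part k).parts, ∀ i ∈ C, ∀ j ∈ C, L.levelVec k i ⬝ᵥ β = L.levelVec k j ⬝ᵥ β}
  add_mem' := by
    rintro a b ⟨ha, ha'⟩ ⟨hb, hb'⟩
    refine ⟨fun j hj => ?_, fun k C hC i hi j hj => ?_⟩
    · rw [dotProduct_add, ha j hj, hb j hj, add_zero]
    · rw [dotProduct_add, dotProduct_add, ha' k C hC i hi j hj, hb' k C hC i hi j hj]
  zero_mem' := by simp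
  smul_mem' := by
    rintro c a ⟨ha, ha'⟩
    refine ⟨fun j hj => ?_, fun k C hC i hi j hj => ?_⟩
    · rw [dotProduct_smul, ha j hj, smul_zero]
    · rw [dotProduct_smul, dotProduct_smul, ha' k C hC i hi j hj]

/-- The size of the model: the dimension of its parameter space. -/
def size : ℕ := Module.finrank ℝ M.space

/-- The full model, without constraints. -/
def full (L : Layout) : Model L where
  cont := Finset.univ
  part _ := ⊥

/-- Index set of the free parameters: the intercept, the kept continuous regressors, and the
clusters that do not contain the reference level. -/
abbrev Free : Type :=
  Unit ⊕ ({j // j ∈ M.cont} ⊕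
    (Σ k : Fin L.numFactors, {C : Finset (L.Level k) // C ∈ (M.part k).parts ∧ 0 ∉ C}))

/-- The matrix `A¹_M`, which recovers the parameter vector from the free parameters. -/
def A1 : Matrix L.Param M.Free ℝ :=
  Matrix.of fun a f => match a, f with
    | Sum.inl _, Sum.inl _ => 1
    | Sum.inr (Sum.inl j), Sum.inr (Sum.inl j') => if j = j' then 1 else 0
    | Sum.inr (Sum.inr q), Sum.inr (Sum.inr C) =>
        if ∃ i ∈ C.2.1, (⟨C.1, i⟩ : Σ k, L.Level k) = ⟨q.1, q.2.succ⟩ then 1 else 0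
    | _, _ => 0

/-- `Σ_M = A¹ (A¹ᵀ Σ A¹)⁻¹ A¹ᵀ`. -/
def limitCov (S : Matrix L.Param L.Param ℝ) : Matrix L.Param L.Param ℝ :=
  M.A1 * (M.A1ᵀ * S * M.A1)⁻¹ * M.A1ᵀ

/-- `M` is a true model of minimal size for the parameter vector `β`. -/
def IsMinimalTrue (β : L.Param → ℝ) : Prop :=
  β ∈ M.space ∧ ∀ M' : Model L, β ∈ M'.space → M.size ≤ M'.size

end Model

section Estimation

variable {L : Layout} {n : ℕ} (D : Data L n) (y : Fin n → ℝ)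

/-- The model matrix `Z₁ = X A¹` of the unconstrained parametrization. -/
def Z1 (M : Model L) : Matrix (Fin n) M.Free ℝ := D.X * M.A1

/-- The least squares estimator constrained to the model `M`. -/
def betaHat (M : Model L) : L.Param → ℝ :=
  M.A1 *ᵥ (((Z1 D M)ᵀ * Z1 D M)⁻¹ *ᵥ ((Z1 D M)ᵀ *ᵥ y))

/-- The projection matrix `H_M = Z₁ (Z₁ᵀ Z₁)⁻¹ Z₁ᵀ`. -/
def hat (M : Model L) : Matrix (Fin n) (Fin n) ℝ :=
  Z1 D M * ((Z1 D M)ᵀ * Z1 D M)⁻¹ * (Z1 D M)ᵀ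

/-- Residual sum of squares of a parameter vector. -/
def rssOf (b : L.Param → ℝ) : ℝ := ∑ i, (y i - (D.X *ᵥ b) i) ^ 2

/-- Residual sum of squares of a model. -/
def rss (M : Model L) : ℝ := rssOf D y (betaHat D y M)

/-- Generalized information criterion with penalty `r`. -/
def gic (r : ℝ) (M : Model L) : ℝ := n * Real.log (rss D y M) + r * M.size

/-- The least squares estimator without constraints. -/
def olsFull : L.Param → ℝ := (D.Xᵀ * D.X)⁻¹ *ᵥ (D.Xᵀ *ᵥ y)

/-- The unbiased variance estimator of the full model. -/
def sigmaHatSq : ℝ := rssOf D y (olsFull D y) / ((n : ℝ) - L.numParams)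

/-- Squared t-statistic of the constraint `a ⬝ β = 0`. -/
def tSq (a : L.Param → ℝ) : ℝ :=
  (a ⬝ᵥ olsFull D y) ^ 2 / (sigmaHatSq D y * (a ⬝ᵥ ((D.Xᵀ * D.X)⁻¹ *ᵥ a)))

/-- Dissimilarity of two levels of factor `k`: the squared t-statistic of the equality of their
coefficients (the coefficient of the reference level being `0`). -/
def dissim (k : Fin L.numFactors) (i j : L.Level k) : ℝ :=
  tSq D y (L.levelVec k i - L.levelVec k j)

/-- `Δ_M = βᵀ Xᵀ (I - H_M) X β`. -/
def loss (β : L.Param → ℝ) (M : Model L) : ℝ :=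
  (D.X *ᵥ β) ⬝ᵥ ((1 - hat D M) *ᵥ (D.X *ᵥ β))

/-- `Δ`, the minimum of `Δ_M` over the models `M` with exactly one constraint, which is false
(with value `∞` if there is no such model). -/
def minLoss (β : L.Param → ℝ) (T : Model L) : ℝ≥0∞ :=
  ⨅ M ∈ {M : Model L | M.size + 1 = (Model.full L).size ∧ ¬ T.space ≤ M.space},
    ENNReal.ofReal (loss D β M)

end Estimation

/-! ### The procedure -/

/-- A run of agglomerative clustering of `m + 1` points with dissimilarity `d`. In each of the
`m` steps two clusters at minimal distance are merged (ties are broken arbitrarily). The distance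
from the merged cluster to any other cluster is a convex combination of the minimum and
the maximum of the distances from the two merged clusters; the weight `b ∈ [0, 1]` may be the
same throughout or vary from one update to another. -/
structure Clustering {m : ℕ} (d : Fin (m + 1) → Fin (m + 1) → ℝ) where
  /-- The partition before step `s`. -/
  part : ℕ → Finpartition (Finset.univ : Finset (Fin (m + 1)))
  /-- The distances between clusters before step `s`. -/
  dist : ℕ → Finset (Fin (m + 1)) → Finset (Fin (m + 1)) → ℝ
  /-- The two clusters merged in step `s`. -/
  left : ℕ → Finset (Fin (m + 1))
  right : ℕ → Finset (Fin (m + 1))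
  part_zero : part 0 = ⊥
  dist_zero : ∀ i j, dist 0 {i} {j} = d i j
  left_mem : ∀ s < m, left s ∈ (part s).parts
  right_mem : ∀ s < m, right s ∈ (part s).parts
  left_ne_right : ∀ s < m, left s ≠ right s
  minimal : ∀ s < m, ∀ C ∈ (part s).parts, ∀ E ∈ (part s).parts, C ≠ E →
    dist s (left s) (right s) ≤ dist s C E
  merge : ∀ s < m, (part (s + 1)).parts =
    insert (left s ∪ right s) (((part s).parts.erase (left s)).erase (right s))
  linkage : ∀ s < m, ∀ C ∈ (part s).parts, C ≠ left s → C ≠ right s →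
    ∃ b ∈ Set.Icc (0 : ℝ) 1, dist (s + 1) (left s ∪ right s) C =
      b * min (dist s (left s) C) (dist s (right s) C) +
        (1 - b) * max (dist s (left s) C) (dist s (right s) C)
  linkage_symm : ∀ s < m, ∀ C ∈ (part s).parts, C ≠ left s → C ≠ right s →
    dist (s + 1) C (left s ∪ right s) = dist (s + 1) (left s ∪ right s) C
  dist_other : ∀ s < m, ∀ C ∈ (part s).parts, ∀ E ∈ (part s).parts,
    C ≠ left s → C ≠ right s → E ≠ left s → E ≠ right s → dist (s + 1) C E = dist s C E

/-- The cutting height of step `s`. -/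
def Clustering.height {m : ℕ} {d : Fin (m + 1) → Fin (m + 1) → ℝ} (c : Clustering d)
    (s : ℕ) : ℝ :=
  c.dist s (c.left s) (c.right s)

section Procedure

variable {L : Layout} {n : ℕ} (D : Data L n) (y : Fin n → ℝ)

/-- The height of an elementary constraint: the squared t-statistic for a continuous regressor,
the cutting height for a merging step of a factor. -/
def stepHeight (c : ∀ k, Clustering (dissim D y k)) : L.Step → ℝ
  | Sum.inl j => tSq D y (L.contVec j)
  | Sum.inr q => (c q.1).height q.2

/-- The elementary constraint of a step, as a row of the constraint matrix. For a merging step it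
equates the coefficients of the minimal levels of the two merged clusters (for a nonempty finite
set `C` of levels, `C.inf id` is its minimum). -/
def stepVec (c : ∀ k, Clustering (dissim D y k)) : L.Step → L.Param → ℝ
  | Sum.inl j => L.contVec j
  | Sum.inr q => L.levelVec q.1 (((c q.1).left q.2).inf id) -
      L.levelVec q.1 (((c q.1).right q.2).inf id)

/-- `M` is an output of the procedure for the data `D`, `y` and the penalty `r`: each factor is
clustered; the elementary constraints are sorted by increasing height; `path m` is the
model given by the first `m` constraints; `M` minimizes the criterion along the path. -/
def IsOutput (r : ℝ) (M : Model L) : Prop :=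
  ∃ (c : ∀ k, Clustering (dissim D y k)) (e : Fin (Fintype.card L.Step) ≃ L.Step)
    (path : Fin (Fintype.card L.Step + 1) → Model L),
    Monotone (fun i => stepHeight D y c (e i)) ∧
    (∀ m, ∀ b : L.Param → ℝ, b ∈ (path m).space ↔
      ∀ i : Fin (Fintype.card L.Step), (i : ℕ) < (m : ℕ) → stepVec D y c (e i) ⬝ᵥ b = 0) ∧
    ∃ m, M = path m ∧ ∀ m', gic D y r (path m) ≤ gic D y r (path m')

end Procedure

/-! ### Asymptotic setting -/

/-- `f ≺ g`, that is `f = o(g)`, for sequences in `[0, ∞]`. -/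
def Prec (f g : ℕ → ℝ≥0∞) : Prop := Tendsto (fun n => f n / g n) atTop (𝓝 0)

/-- The assumptions. For the sample size `n` we have the layout `L n`, the regressors `D n`, the
parameter vector `β n`, the minimal true model `T n`, Gaussian errors `ε n` with variance `σ ^ 2`,
the penalty `r n`, and the selected model `That n`. -/
structure Setting {Ω : ℕ → Type*} [∀ n, MeasurableSpace (Ω n)] (P : ∀ n, Measure (Ω n))
    (L : ℕ → Layout) (D : ∀ n, Data (L n) n) (β : ∀ n, (L n).Param → ℝ) (T : ∀ n, Model (L n))
    (σ : ℝ) (ε : ∀ n, Ω n → Fin n → ℝ) (r : ℕ → ℝ) (That : ∀ n, Ω n → Model (L n)) : Prop where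
  sigma_pos : 0 < σ
  /-- The errors are i.i.d. `N(0, σ²)`. -/
  errors : ∀ n, HasLaw (ε n) (Measure.pi fun _ => gaussianReal 0 (σ ^ 2).toNNReal) (P n)
  /-- The model matrix is of full rank. -/
  full_rank : ∀ᶠ n in atTop, (D n).X.rank = (L n).numParams
  true_model : ∀ n, (T n).IsMinimalTrue (β n)
  /-- The size of the true model does not grow; this is all that is needed from
  a true model that does not depend on the sample size. -/
  true_size : ∃ K : ℕ, ∀ n, (T n).size ≤ K
  /-- `p_n ≺ r_n` (in particular `r_n > 0` eventually). -/
  params_prec : Prec (fun n => ((L n).numParams : ℝ≥0∞)) (fun n => ENNReal.ofReal (r n))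
  /-- `r_n ≺ min (n, Δ)`. -/
  penalty_prec : Prec (fun n => ENNReal.ofReal (r n))
    (fun n => min (n : ℝ≥0∞) (minLoss (D n) (β n) (T n)))
  /-- The selected model is an output of the procedure for the response `y = X β + ε`. -/
  selected : ∀ n ω, IsOutput (D n) ((D n).X *ᵥ β n + ε n ω) (r n) (That n ω)
  measurable_selected : ∀ n M, MeasurableSet {ω | That n ω = M}

end DMR

end

/-! Randomness enters through two numbers attached to the error vector `e`: its squared length and W
= `projSq`, the squared length of its projection on the column space of `X`. Markov's inequality
with E W = σ²p and p = o(r) makes W small compared with r; Chebyshev's inequality keeps the squared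
length of `e` within nσ²/2 of nσ². The rest of (a) is deterministic: under these bounds, collected
in `Recovers`, every output of the procedure is T (`Recovers.eq_of_isOutput`).

Put δ = min(n, Δ) and, for a constraint vector a, Q = aᵀ(XᵀX)⁻¹a. If a is a true constraint,
Cauchy-Schwarz bounds the squared estimate of aᵀβ by QW. If a is elementary and false, (aᵀβ)²/Q is
the squared distance from Xβ to the image of the hyperplane of a, hence at least Δ. Since W ≤ δ/16,
all true t² lie below a level `lo` and all false ones above `hi` = 9 `lo`. A linkage between the
minimum and the maximum cannot carry distances across this gap. So each clustering first merges all
levels with equal coefficients, at heights at most `lo`, and only afterwards makes false mergers, at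
heights at least `hi` (`height_dichotomy`). The constraints of the low mergers generate all
equalities between levels (`eq_of_low_steps`), so sorting places T on the path.

Along the path the criterion singles out T. A false constraint raises RSS by at least δ/2 and n log
RSS by a multiple of δ, which exceeds r|T| because |T| is bounded (`gic_lt_of_false`). A path model
strictly larger than T lowers n log RSS by less than r, the price of one dimension (`gic_lt_of_lt`).

For (b), the scaled error of the estimator in T is a linear image of `e`, hence exactly Gaussian for
each large n, with covariance σ² `limitCov` (XᵀX/n). Replacing T by the selected model changes its
characteristic function by at most 2 P(That ≠ T), and Lévy's continuity theorem concludes. -/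

namespace DMR

/-! ### Agglomerative clustering of well separated points -/

namespace Clustering

variable {m : ℕ} {d : Fin (m + 1) → Fin (m + 1) → ℝ}

theorem inf_mem {C : Finset (Fin (m + 1))} (hC : C.Nonempty) : C.inf id ∈ C := by
  obtain ⟨i, hi, h⟩ := C.exists_mem_eq_inf hC id
  rw [h]
  exact hi

theorem nonempty_of_mem_part (c : Clustering d) {s : ℕ} {C : Finset (Fin (m + 1))}
    (hC : C ∈ (c.part s).parts) : C.Nonempty :=
  (c.part s).nonempty_of_mem_parts hC

theorem left_inf_mem (c : Clustering d) {s : ℕ} (hs : s < m) : (c.left s).inf id ∈ c.left s :=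
  inf_mem (c.nonempty_of_mem_part (c.left_mem s hs))

theorem right_inf_mem (c : Clustering d) {s : ℕ} (hs : s < m) :
    (c.right s).inf id ∈ c.right s :=
  inf_mem (c.nonempty_of_mem_part (c.right_mem s hs))

theorem union_notMem (c : Clustering d) {s : ℕ} (hs : s < m) :
    c.left s ∪ c.right s ∉ (((c.part s).parts.erase (c.left s)).erase (c.right s)) := by
  intro h
  simp only [Finset.mem_erase] at h
  obtain ⟨i, hi⟩ := c.nonempty_of_mem_part (c.left_mem s hs)
  exact h.2.1 ((c.part s).eq_of_mem_parts h.2.2 (c.left_mem s hs)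
    (Finset.mem_union_left _ hi) hi)

theorem card_part (c : Clustering d) : ∀ s ≤ m, (c.part s).parts.card = m + 1 - s := by
  intro s
  induction s with
  | zero => intro _; simp [c.part_zero]
  | succ s ih =>
    intro hs
    have h := ih (by omega)
    have hs' : s < m := by omega
    rw [c.merge s hs', Finset.card_insert_of_notMem (c.union_notMem hs'),
      Finset.card_erase_of_mem, Finset.card_erase_of_mem (c.left_mem s hs'), h]
    · omega
    · simp [(c.left_ne_right s hs').symm, c.right_mem s hs']

theorem mem_part_succ (c : Clustering d) {s : ℕ} (hs : s < m) {C : Finset (Fin (m + 1))} :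
    C ∈ (c.part (s + 1)).parts ↔ C = c.left s ∪ c.right s ∨
      (C ≠ c.left s ∧ C ≠ c.right s ∧ C ∈ (c.part s).parts) := by
  rw [c.merge s hs]
  simp only [Finset.mem_insert, Finset.mem_erase]
  tauto

/-- A property of distances that is stable under convex combinations of minima and maxima
is inherited by the distances after a merger. -/
theorem dist_succ_mem (c : Clustering d) {s : ℕ} (hs : s < m) {I : Set ℝ} (hI : I.OrdConnected)
    {C E : Finset (Fin (m + 1))} (hC : C ∈ (c.part (s + 1)).parts)
    (hE : E ∈ (c.part (s + 1)).parts) (hCE : C ≠ E)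
    (hI' : ∀ C' ∈ (c.part s).parts, ∀ E' ∈ (c.part s).parts, C' ⊆ C → E' ⊆ E →
      c.dist s C' E' ∈ I ∧ c.dist s E' C' ∈ I) :
    c.dist (s + 1) C E ∈ I := by
  have key : ∀ C' ∈ (c.part s).parts, C' ≠ c.left s → C' ≠ c.right s →
      c.dist s (c.left s) C' ∈ I → c.dist s (c.right s) C' ∈ I →
      c.dist (s + 1) (c.left s ∪ c.right s) C' ∈ I := by
    intro C' hC' h1 h2 hl hr
    obtain ⟨b, ⟨hb0, hb1⟩, hb⟩ := c.linkage s hs C' hC' h1 h2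
    rw [hb]
    have hmin : min (c.dist s (c.left s) C') (c.dist s (c.right s) C') ∈ I := by
      rcases min_choice (c.dist s (c.left s) C') (c.dist s (c.right s) C') with h | h <;>
        rw [h] <;> assumption
    have hmax : max (c.dist s (c.left s) C') (c.dist s (c.right s) C') ∈ I := by
      rcases max_choice (c.dist s (c.left s) C') (c.dist s (c.right s) C') with h | h <;>
        rw [h] <;> assumption
    exact hI.convex hmin hmax hb0 (by linarith) (by ring)
  rw [c.mem_part_succ hs] at hC hE
  rcases hC with rfl | ⟨hC1, hC2, hC⟩ <;> rcases hE with rfl | ⟨hE1, hE2, hE⟩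
  · exact absurd rfl hCE
  · exact key E hE hE1 hE2
      (hI' _ (c.left_mem s hs) _ hE Finset.subset_union_left subset_rfl).1
      (hI' _ (c.right_mem s hs) _ hE Finset.subset_union_right subset_rfl).1
  · rw [c.linkage_symm s hs C hC hC1 hC2]
    exact key C hC hC1 hC2
      (hI' _ hC _ (c.left_mem s hs) subset_rfl Finset.subset_union_left).2
      (hI' _ hC _ (c.right_mem s hs) subset_rfl Finset.subset_union_right).2
  · rw [c.dist_other s hs C hC E hE hC1 hC2 hE1 hE2]
    exact (hI' _ hC _ hE subset_rfl subset_rfl).1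

variable (f g : Fin (m + 1) → ℝ) (lo hi : ℝ)

/-- Before step `s` the clusters lie within the fibres of `f`, clusters in the same fibre are close,
clusters in different fibres are far apart, and `g` is constant on clusters. -/
structure Within (c : Clustering d) (s : ℕ) : Prop where
  fibre : ∀ C ∈ (c.part s).parts, ∀ i ∈ C, ∀ j ∈ C, f i = f j
  const : ∀ C ∈ (c.part s).parts, ∀ i ∈ C, ∀ j ∈ C, g i = g j
  close : ∀ C ∈ (c.part s).parts, ∀ E ∈ (c.part s).parts, C ≠ E →
    (∀ i ∈ C, ∀ j ∈ E, f i = f j) → c.dist s C E ≤ lo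
  far : ∀ C ∈ (c.part s).parts, ∀ E ∈ (c.part s).parts,
    (∀ i ∈ C, ∀ j ∈ E, f i ≠ f j) → hi ≤ c.dist s C E

/-- Before step `s` the clusters are unions of fibres of `f`, all clusters are far apart, and `g` is
constant on the fibres. -/
structure Saturated (c : Clustering d) (s : ℕ) : Prop where
  fibre : ∀ C ∈ (c.part s).parts, ∀ i ∈ C, ∀ j, f i = f j → j ∈ C
  const : ∀ i j, f i = f j → g i = g j
  far : ∀ C ∈ (c.part s).parts, ∀ E ∈ (c.part s).parts, C ≠ E → hi ≤ c.dist s C E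

variable {f g lo hi}

theorem exists_mem_part (c : Clustering d) (s : ℕ) (i : Fin (m + 1)) :
    ∃ C ∈ (c.part s).parts, i ∈ C :=
  (c.part s).exists_mem (Finset.mem_univ i)

theorem Within.ne_or_eq {c : Clustering d} {s : ℕ} (h : Within f g lo hi c s)
    {C E : Finset (Fin (m + 1))} (hC : C ∈ (c.part s).parts) (hE : E ∈ (c.part s).parts) :
    (∀ i ∈ C, ∀ j ∈ E, f i = f j) ∨ (∀ i ∈ C, ∀ j ∈ E, f i ≠ f j) := by
  by_contra! hcon
  obtain ⟨⟨i, hi, j, hj, hij⟩, i', hi', j', hj', hij'⟩ := hcon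
  exact hij ((h.fibre C hC i hi i' hi').trans (hij'.trans (h.fibre E hE j' hj' j hj)))

/-- While some fibre is still split, two of its clusters are at distance at most `lo` < `hi`, so the
closest pair cannot come from different fibres. The hypothesis on `g` concerns only the least
elements of merged clusters; constancy on clusters carries it to all their elements. -/
theorem Within.step {c : Clustering d} {s : ℕ} (hs : s < m) (hlohi : lo < hi)
    (hg : ∀ s < m, c.height s ≤ lo → g ((c.left s).inf id) = g ((c.right s).inf id))
    (h : Within f g lo hi c s) (hsat : ¬ Saturated f g hi c s) :
    c.height s ≤ lo ∧ f ((c.left s).inf id) = f ((c.right s).inf id) ∧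
      Within f g lo hi c (s + 1) := by
  -- If no two distinct clusters shared a fibre, every cluster would be a whole fibre, which is the
  -- saturated state.
  have hex : ∃ C ∈ (c.part s).parts, ∃ E ∈ (c.part s).parts, C ≠ E ∧
      ∀ i ∈ C, ∀ j ∈ E, f i = f j := by
    by_contra! hcon
    have hfar : ∀ C ∈ (c.part s).parts, ∀ E ∈ (c.part s).parts, C ≠ E →
        ∀ i ∈ C, ∀ j ∈ E, f i ≠ f j := by
      intro C hC E hE hCE
      rcases h.ne_or_eq hC hE with h' | h'
      · obtain ⟨i, hi, j, hj, hij⟩ := hcon C hC E hE hCE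
        exact absurd (h' i hi j hj) hij
      · exact h'
    have hfib : ∀ C ∈ (c.part s).parts, ∀ i ∈ C, ∀ j, f i = f j → j ∈ C := by
      intro C hC i hi j hij
      obtain ⟨E, hE, hj⟩ := c.exists_mem_part s j
      by_contra hjC
      exact hfar C hC E hE (fun hCE => hjC (hCE ▸ hj)) i hi j hj hij
    refine hsat ⟨hfib, fun i j hij => ?_,
      fun C hC E hE hCE => h.far C hC E hE (hfar C hC E hE hCE)⟩
    obtain ⟨C, hC, hi⟩ := c.exists_mem_part s i
    exact h.const C hC i hi j (hfib C hC i hi j hij)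
  obtain ⟨C, hC, E, hE, hCE, hf⟩ := hex
  have hheight : c.height s ≤ lo := (c.minimal s hs C hC E hE hCE).trans (h.close C hC E hE hCE hf)
  have hl := c.left_mem s hs
  have hr := c.right_mem s hs
  have hlr : ∀ i ∈ c.left s, ∀ j ∈ c.right s, f i = f j := by
    rcases h.ne_or_eq hl hr with h' | h'
    · exact h'
    · exact absurd (h.far _ hl _ hr h') (not_le.2 (hheight.trans_lt hlohi))
  have hglr : ∀ i ∈ c.left s, ∀ j ∈ c.right s, g i = g j := fun i hi j hj =>
    (h.const _ hl i hi _ (c.left_inf_mem hs)).trans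
      ((hg s hs hheight).trans (h.const _ hr _ (c.right_inf_mem hs) j hj))
  have hconst : ∀ u : Fin (m + 1) → ℝ,
      (∀ C ∈ (c.part s).parts, ∀ i ∈ C, ∀ j ∈ C, u i = u j) →
      (∀ i ∈ c.left s, ∀ j ∈ c.right s, u i = u j) →
      ∀ C ∈ (c.part (s + 1)).parts, ∀ i ∈ C, ∀ j ∈ C, u i = u j := by
    intro u hu hulr C hC i hi j hj
    rcases (c.mem_part_succ hs).1 hC with rfl | ⟨-, -, hC⟩
    · rcases Finset.mem_union.1 hi with hi | hi <;> rcases Finset.mem_union.1 hj with hj | hj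
      · exact hu _ hl i hi j hj
      · exact hulr i hi j hj
      · exact (hulr j hj i hi).symm
      · exact hu _ hr i hi j hj
    · exact hu C hC i hi j hj
  refine ⟨hheight, hlr _ (c.left_inf_mem hs) _ (c.right_inf_mem hs),
    hconst f h.fibre hlr, hconst g h.const hglr, ?_, ?_⟩
  · intro C hC E hE hCE hf
    refine c.dist_succ_mem hs (I := Set.Iic lo) Set.ordConnected_Iic hC hE hCE ?_
    intro C' hC' E' hE' hCC' hEE'
    have hne : C' ≠ E' := by
      rintro rfl
      obtain ⟨i, hi⟩ := c.nonempty_of_mem_part hC'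
      exact hCE ((c.part (s + 1)).eq_of_mem_parts hC hE (hCC' hi) (hEE' hi))
    exact ⟨h.close C' hC' E' hE' hne fun i hi j hj => hf i (hCC' hi) j (hEE' hj),
      h.close E' hE' C' hC' hne.symm fun j hj i hi => (hf i (hCC' hi) j (hEE' hj)).symm⟩
  · intro C hC E hE hf
    have hCE : C ≠ E := by
      rintro rfl
      obtain ⟨i, hi⟩ := c.nonempty_of_mem_part hC
      exact hf i hi i hi rfl
    refine c.dist_succ_mem hs (I := Set.Ici hi) Set.ordConnected_Ici hC hE hCE ?_
    intro C' hC' E' hE' hCC' hEE'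
    exact ⟨h.far C' hC' E' hE' fun i hi j hj => hf i (hCC' hi) j (hEE' hj),
      h.far E' hE' C' hC' fun j hj i hi => (hf i (hCC' hi) j (hEE' hj)).symm⟩

/-- Distinct clusters made of whole fibres share no value of `f`, and unions of whole fibres remain
such, so saturation is never left. -/
theorem Saturated.step {c : Clustering d} {s : ℕ} (hs : s < m) (h : Saturated f g hi c s) :
    hi ≤ c.height s ∧ f ((c.left s).inf id) ≠ f ((c.right s).inf id) ∧
      Saturated f g hi c (s + 1) := by
  have hl := c.left_mem s hs
  have hr := c.right_mem s hs
  refine ⟨h.far _ hl _ hr (c.left_ne_right s hs), fun hf => ?_, ?_, h.const, ?_⟩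
  · exact c.left_ne_right s hs ((c.part s).eq_of_mem_parts hl hr
      (h.fibre _ hl _ (c.left_inf_mem hs) _ hf) (c.right_inf_mem hs))
  · intro C hC i hi j hij
    rcases (c.mem_part_succ hs).1 hC with rfl | ⟨-, -, hC⟩
    · rcases Finset.mem_union.1 hi with hi | hi
      · exact Finset.mem_union_left _ (h.fibre _ hl i hi j hij)
      · exact Finset.mem_union_right _ (h.fibre _ hr i hi j hij)
    · exact h.fibre C hC i hi j hij
  · intro C hC E hE hCE
    refine c.dist_succ_mem hs (I := Set.Ici hi) Set.ordConnected_Ici hC hE hCE ?_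
    intro C' hC' E' hE' hCC' hEE'
    have hne : C' ≠ E' := by
      rintro rfl
      obtain ⟨i, hi⟩ := c.nonempty_of_mem_part hC'
      exact hCE ((c.part (s + 1)).eq_of_mem_parts hC hE (hCC' hi) (hEE' hi))
    exact ⟨h.far C' hC' E' hE' hne, h.far E' hE' C' hC' hne.symm⟩

/-- The dissimilarity separates the fibres of `f`: it is at most `lo` within and at least `hi`
between fibres. -/
def Separates (d : Fin (m + 1) → Fin (m + 1) → ℝ) (f : Fin (m + 1) → ℝ) (lo hi : ℝ) : Prop :=
  ∀ i j, (f i = f j → d i j ≤ lo) ∧ (f i ≠ f j → hi ≤ d i j)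

theorem within_zero (c : Clustering d) (hd : Separates d f lo hi) : Within f g lo hi c 0 := by
  have hpart : ∀ C ∈ (c.part 0).parts, ∃ i, C = {i} := by
    intro C hC
    rw [c.part_zero, Finpartition.mem_bot_iff] at hC
    obtain ⟨i, -, hi⟩ := hC
    exact ⟨i, hi.symm⟩
  constructor
  · intro C hC i hi j hj
    obtain ⟨x, rfl⟩ := hpart C hC
    rw [Finset.mem_singleton.1 hi, Finset.mem_singleton.1 hj]
  · intro C hC i hi j hj
    obtain ⟨x, rfl⟩ := hpart C hC
    rw [Finset.mem_singleton.1 hi, Finset.mem_singleton.1 hj]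
  · intro C hC E hE _ hf
    obtain ⟨x, rfl⟩ := hpart C hC
    obtain ⟨y, rfl⟩ := hpart E hE
    rw [c.dist_zero]
    exact (hd x y).1 (hf x (Finset.mem_singleton_self x) y (Finset.mem_singleton_self y))
  · intro C hC E hE hf
    obtain ⟨x, rfl⟩ := hpart C hC
    obtain ⟨y, rfl⟩ := hpart E hE
    rw [c.dist_zero]
    exact (hd x y).2 (hf x (Finset.mem_singleton_self x) y (Finset.mem_singleton_self y))

/-- A run has two phases: mergers inside fibres until all fibres are complete, then mergers of
complete fibres. -/
theorem within_or_saturated (c : Clustering d) (hlohi : lo < hi) (hd : Separates d f lo hi)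
    (hg : ∀ s < m, c.height s ≤ lo → g ((c.left s).inf id) = g ((c.right s).inf id)) :
    ∀ s ≤ m, Within f g lo hi c s ∨ Saturated f g hi c s := by
  intro s
  induction s with
  | zero => intro _; exact Or.inl (c.within_zero hd)
  | succ s ih =>
    intro hs
    by_cases hsat : Saturated f g hi c s
    · exact Or.inr (hsat.step hs).2.2
    · rcases ih (by omega) with h | h
      · exact Or.inl (h.step hs hlohi hg hsat).2.2
      · exact absurd h hsat

/-- Each merging step is either low and within a fibre or high and between fibres. -/
theorem height_dichotomy (c : Clustering d) (hlohi : lo < hi) (hd : Separates d f lo hi)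
    {s : ℕ} (hs : s < m) :
    (c.height s ≤ lo ∧ f ((c.left s).inf id) = f ((c.right s).inf id)) ∨
      (hi ≤ c.height s ∧ f ((c.left s).inf id) ≠ f ((c.right s).inf id)) := by
  -- Only the heights matter here, so a constant function serves as `g`.
  have hg : ∀ s < m, c.height s ≤ lo →
      (0 : Fin (m + 1) → ℝ) ((c.left s).inf id) = (0 : Fin (m + 1) → ℝ) ((c.right s).inf id) :=
    fun _ _ _ => rfl
  by_cases hsat : Saturated f (0 : Fin (m + 1) → ℝ) hi c s
  · exact Or.inr ⟨(hsat.step hs).1, (hsat.step hs).2.1⟩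
  · rcases c.within_or_saturated hlohi hd hg s hs.le with h | h
    · exact Or.inl ⟨(h.step hs hlohi hg hsat).1, (h.step hs hlohi hg hsat).2.1⟩
    · exact absurd h hsat

/-- The constraints of the low merging steps make a function constant on the fibres. -/
theorem eq_of_low_steps (c : Clustering d) (hlohi : lo < hi) (hd : Separates d f lo hi)
    (hg : ∀ s < m, c.height s ≤ lo → g ((c.left s).inf id) = g ((c.right s).inf id))
    {i j : Fin (m + 1)} (hij : f i = f j) : g i = g j := by
  rcases c.within_or_saturated hlohi hd hg m le_rfl with h | h
  -- After all `m` steps one cluster is left, and `g` is constant on it.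
  · have hcard : (c.part m).parts.card = 1 := by rw [c.card_part m le_rfl]; omega
    obtain ⟨C, hC⟩ := Finset.card_eq_one.1 hcard
    have hmem : ∀ x, x ∈ C := by
      intro x
      obtain ⟨E, hE, hx⟩ := c.exists_mem_part m x
      rw [hC, Finset.mem_singleton] at hE
      exact hE ▸ hx
    exact h.const C (by simp [hC]) i (hmem i) j (hmem j)
  · exact h.const i j hij

end Clustering

/-! ### Spaces of feasible models -/

namespace Layout

variable (L : Layout)

theorem contVec_dotProduct (j : Fin L.numCont) (b : L.Param → ℝ) :
    L.contVec j ⬝ᵥ b = b (Sum.inr (Sum.inl j)) := by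
  simp [contVec]

@[simp]
theorem levelVec_zero (k : Fin L.numFactors) : L.levelVec k 0 = 0 := rfl

theorem levelVec_succ_dotProduct (k : Fin L.numFactors) (j : Fin (L.extraLevels k))
    (b : L.Param → ℝ) : L.levelVec k j.succ ⬝ᵥ b = b (Sum.inr (Sum.inr ⟨k, j⟩)) := by
  simp [levelVec]

/-- Parameter vectors with the same intercept, the same coefficients of the continuous
regressors and of the levels are equal. -/
theorem param_ext {b b' : L.Param → ℝ} (h0 : b (Sum.inl ()) = b' (Sum.inl ()))
    (hc : ∀ j, L.contVec j ⬝ᵥ b = L.contVec j ⬝ᵥ b')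
    (hl : ∀ k i, L.levelVec k i ⬝ᵥ b = L.levelVec k i ⬝ᵥ b') : b = b' := by
  funext a
  rcases a with _ | j | ⟨k, j⟩
  · exact h0
  · simpa [contVec_dotProduct] using hc j
  · simpa [levelVec_succ_dotProduct] using hl k j.succ

end Layout

namespace Model

variable {L : Layout} (M : Model L)

theorem finpartition_ext {α : Type*} [DecidableEq α] [Fintype α]
    {P Q : Finpartition (Finset.univ : Finset α)} (h : ∀ i j, j ∈ P.part i ↔ j ∈ Q.part i) :
    P = Q := by
  have h' : ∀ i, P.part i = Q.part i := fun i => Finset.ext (h i)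
  refine Finpartition.ext (Finset.ext fun C => ⟨fun hC => ?_, fun hC => ?_⟩)
  · obtain ⟨i, hi⟩ := P.nonempty_of_mem_parts hC
    rw [← P.part_eq_of_mem hC hi, h']
    exact Q.part_mem.2 (Finset.mem_univ i)
  · obtain ⟨i, hi⟩ := Q.nonempty_of_mem_parts hC
    rw [← Q.part_eq_of_mem hC hi, ← h']
    exact P.part_mem.2 (Finset.mem_univ i)

theorem mem_space {b : L.Param → ℝ} :
    b ∈ M.space ↔ (∀ j, j ∉ M.cont → L.contVec j ⬝ᵥ b = 0) ∧
      ∀ k i j, j ∈ (M.part k).part i → L.levelVec k i ⬝ᵥ b = L.levelVec k j ⬝ᵥ b := by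
  refine and_congr Iff.rfl ⟨fun h k i j hij => ?_, fun h k C hC i hi j hj => ?_⟩
  · exact h k _ ((M.part k).part_mem.2 (Finset.mem_univ i)) i
      ((M.part k).mem_part (Finset.mem_univ i)) j hij
  · exact h k i j (by rwa [(M.part k).part_eq_of_mem hC hi])

/-! ### Parametrization of the space of a model by the matrix `A1`. -/

theorem A1_mulVec_intercept (u : M.Free → ℝ) : (M.A1 *ᵥ u) (Sum.inl ()) = u (Sum.inl ()) := by
  simp [A1, Matrix.mulVec, dotProduct]

theorem contVec_A1_mulVec (u : M.Free → ℝ) (j : Fin L.numCont) :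
    L.contVec j ⬝ᵥ (M.A1 *ᵥ u) = if h : j ∈ M.cont then u (Sum.inr (Sum.inl ⟨j, h⟩)) else 0 := by
  rw [L.contVec_dotProduct]
  simp only [A1, Matrix.mulVec, dotProduct, Fintype.sum_sum_type, Matrix.of_apply]
  simp only [zero_mul, Finset.sum_const_zero, zero_add, add_zero, ite_mul, one_mul]
  split_ifs with h
  · rw [Finset.sum_eq_single (⟨j, h⟩ : {j // j ∈ M.cont})]
    · simp
    · intro b _ hb
      rw [if_neg]
      rintro rfl
      exact hb rfl
    · simp
  · refine Finset.sum_eq_zero fun b _ => if_neg ?_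
    rintro rfl
    exact h b.2

theorem levelVec_A1_mulVec (u : M.Free → ℝ) (k : Fin L.numFactors) (i : L.Level k) :
    L.levelVec k i ⬝ᵥ (M.A1 *ᵥ u) =
      if h : 0 ∉ (M.part k).part i then
        u (Sum.inr (Sum.inr ⟨k, (M.part k).part i, (M.part k).part_mem.2 (Finset.mem_univ i), h⟩))
      else 0 := by
  induction i using Fin.cases with
  | zero =>
    have h : (0 : L.Level k) ∈ (M.part k).part 0 := (M.part k).mem_part (Finset.mem_univ _)
    rw [dif_neg (not_not.2 h)]
    simp
  | succ x =>
    rw [L.levelVec_succ_dotProduct]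
    simp only [A1, Matrix.mulVec, dotProduct, Fintype.sum_sum_type, Matrix.of_apply]
    simp only [zero_mul, Finset.sum_const_zero, zero_add, ite_mul, one_mul]
    -- The row of a level has at most one nonzero entry among the cluster columns: that of its own
    -- cluster, which has a column only if it avoids the reference level.
    have hpart : ∀ C : (Σ k : Fin L.numFactors,
        {C : Finset (L.Level k) // C ∈ (M.part k).parts ∧ 0 ∉ C}),
        (∃ i ∈ C.2.1, (⟨C.1, i⟩ : Σ k, L.Level k) = ⟨k, x.succ⟩) →
        ∃ h : 0 ∉ (M.part k).part x.succ,
          C = ⟨k, (M.part k).part x.succ, (M.part k).part_mem.2 (Finset.mem_univ _), h⟩ := by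
      rintro ⟨k', C, hC, hC0⟩ ⟨i, hi, he⟩
      dsimp only at hi he
      obtain ⟨rfl, he⟩ := Sigma.mk.inj_iff.1 he
      obtain rfl := eq_of_heq he
      obtain rfl : C = (M.part k').part x.succ := ((M.part k').part_eq_of_mem hC hi).symm
      exact ⟨hC0, rfl⟩
    by_cases h : 0 ∉ (M.part k).part x.succ
    · rw [dif_pos h, Finset.sum_eq_single (⟨k, (M.part k).part x.succ,
        (M.part k).part_mem.2 (Finset.mem_univ _), h⟩ : Σ k : Fin L.numFactors,
        {C : Finset (L.Level k) // C ∈ (M.part k).parts ∧ 0 ∉ C})]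
      · rw [if_pos]
        exact ⟨x.succ, (M.part k).mem_part (Finset.mem_univ _), rfl⟩
      · intro C _ hC
        rw [if_neg]
        intro hcon
        obtain ⟨_, h'⟩ := hpart C hcon
        exact hC h'
      · simp
    · rw [dif_neg h]
      refine Finset.sum_eq_zero fun C _ => if_neg fun hcon => ?_
      obtain ⟨h', -⟩ := hpart C hcon
      exact h h'

theorem A1_mulVec_mem_space (u : M.Free → ℝ) : M.A1 *ᵥ u ∈ M.space := by
  refine M.mem_space.2 ⟨fun j hj => ?_, fun k i j hij => ?_⟩
  · rw [contVec_A1_mulVec, dif_neg hj]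
  · have : (M.part k).part j = (M.part k).part i :=
      (M.part k).part_eq_of_mem ((M.part k).part_mem.2 (Finset.mem_univ i)) hij
    simp only [levelVec_A1_mulVec, this]

theorem A1_mulVec_injective : Function.Injective (fun u => M.A1 *ᵥ u) := by
  intro u u' h
  simp only at h
  funext a
  rcases a with _ | ⟨j, hj⟩ | ⟨k, C, hC, hC0⟩
  · have := congrFun h (Sum.inl ())
    rwa [A1_mulVec_intercept, A1_mulVec_intercept] at this
  · have := congrArg (fun b => L.contVec j ⬝ᵥ b) h
    simpa only [contVec_A1_mulVec, dif_pos hj] using this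
  · obtain ⟨i, hi⟩ := (M.part k).nonempty_of_mem_parts hC
    have := congrArg (fun b => L.levelVec k i ⬝ᵥ b) h
    have hpart := (M.part k).part_eq_of_mem hC hi
    subst hpart
    simpa only [levelVec_A1_mulVec, dif_pos hC0] using this

theorem exists_A1_mulVec_eq {b : L.Param → ℝ} (hb : b ∈ M.space) : ∃ u, M.A1 *ᵥ u = b := by
  obtain ⟨hc, hl⟩ := M.mem_space.1 hb
  -- The free parameter of a cluster is read off at its least level; any other level of the cluster
  -- gives the same value.
  refine ⟨Sum.elim (fun _ => b (Sum.inl ())) (Sum.elim (fun j => L.contVec j ⬝ᵥ b)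
    (fun C => L.levelVec C.1 (C.2.1.inf id) ⬝ᵥ b)), L.param_ext ?_ ?_ ?_⟩
  · rw [A1_mulVec_intercept]; rfl
  · intro j
    rw [contVec_A1_mulVec]
    split_ifs with h
    · rfl
    · exact (hc j h).symm
  · intro k i
    rw [levelVec_A1_mulVec]
    split_ifs with h
    · rw [hl k i 0 h, L.levelVec_zero, zero_dotProduct]
    · exact (hl k i _ (Clustering.inf_mem ⟨i, (M.part k).mem_part (Finset.mem_univ i)⟩)).symm

/-! ### Recovering a model from its space. -/

theorem mem_cont_iff {j : Fin L.numCont} : j ∈ M.cont ↔ ∃ b ∈ M.space, L.contVec j ⬝ᵥ b ≠ 0 := by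
  classical
  constructor
  · intro hj
    refine ⟨M.A1 *ᵥ Pi.single (Sum.inr (Sum.inl ⟨j, hj⟩)) 1, M.A1_mulVec_mem_space _, ?_⟩
    rw [contVec_A1_mulVec, dif_pos hj]
    simp
  · rintro ⟨b, hb, hne⟩
    by_contra hj
    exact hne ((M.mem_space.1 hb).1 j hj)

/-- The witness is the indicator of the cluster of `i`, a column of `A1` because this cluster avoids
the reference level. -/
theorem exists_levelVec_ne {k : Fin L.numFactors} {i j : L.Level k}
    (hij : j ∉ (M.part k).part i) (h0 : 0 ∉ (M.part k).part i) :
    ∃ b ∈ M.space, L.levelVec k i ⬝ᵥ b ≠ L.levelVec k j ⬝ᵥ b := by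
  classical
  refine ⟨M.A1 *ᵥ Pi.single (Sum.inr (Sum.inr ⟨k, (M.part k).part i,
    (M.part k).part_mem.2 (Finset.mem_univ i), h0⟩)) 1, M.A1_mulVec_mem_space _, ?_⟩
  have hne : (M.part k).part j ≠ (M.part k).part i := fun h =>
    hij (h ▸ (M.part k).mem_part (Finset.mem_univ j))
  rw [levelVec_A1_mulVec, levelVec_A1_mulVec, dif_pos h0, Pi.single_eq_same]
  split_ifs with h
  · exact one_ne_zero
  · rw [Pi.single_eq_of_ne]
    · exact one_ne_zero
    · simpa using hne

theorem mem_part_iff {k : Fin L.numFactors} {i j : L.Level k} :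
    j ∈ (M.part k).part i ↔ ∀ b ∈ M.space, L.levelVec k i ⬝ᵥ b = L.levelVec k j ⬝ᵥ b := by
  refine ⟨fun h b hb => (M.mem_space.1 hb).2 k i j h, fun h => ?_⟩
  by_contra hij
  have hmem : ∀ x, (M.part k).part x ∈ (M.part k).parts := fun x =>
    (M.part k).part_mem.2 (Finset.mem_univ x)
  have hself : ∀ x, x ∈ (M.part k).part x := fun x => (M.part k).mem_part (Finset.mem_univ x)
  -- If the cluster of `i` contains the reference level, that of `j` does not, and the roles are
  -- exchanged.
  by_cases h0 : 0 ∈ (M.part k).part i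
  · have hne : i ∉ (M.part k).part j := fun hc =>
      hij ((M.part k).part_eq_of_mem (hmem j) hc ▸ hself j)
    have h0' : 0 ∉ (M.part k).part j := fun hc =>
      hij ((M.part k).eq_of_mem_parts (hmem j) (hmem i) hc h0 ▸ hself j)
    obtain ⟨b, hb, hne⟩ := M.exists_levelVec_ne hne h0'
    exact hne (h b hb).symm
  · obtain ⟨b, hb, hne⟩ := M.exists_levelVec_ne hij h0
    exact hne (h b hb)

/-- The path of the procedure is specified through spaces only; injectivity turns equality of spaces
into equality of the selected and the true model. -/
theorem space_injective : Function.Injective (space : Model L → _) := by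
  intro M M' h
  refine Model.ext (Finset.ext fun j => ?_) (funext fun k => finpartition_ext fun i j => ?_)
  · rw [mem_cont_iff, mem_cont_iff, h]
  · rw [mem_part_iff, mem_part_iff, h]

instance : Finite (Model L) :=
  Finite.of_injective (fun M : Model L => (M.cont, M.part)) fun M M' h => by
    simp only [Prod.mk.injEq] at h
    exact Model.ext h.1 h.2

open Classical in
/-- The model that keeps the continuous regressors in `s` and whose clusters are the fibres of the
functions `lab k`. -/
noncomputable def ofLabels {α : Fin L.numFactors → Type*} (s : Set (Fin L.numCont))
    (lab : ∀ k, L.Level k → α k) : Model L where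
  cont := s.toFinset
  part k := Finpartition.ofSetoid (Setoid.ker (lab k))

theorem mem_space_ofLabels {α : Fin L.numFactors → Type*} {s : Set (Fin L.numCont)}
    {lab : ∀ k, L.Level k → α k} {b : L.Param → ℝ} :
    b ∈ (ofLabels s lab).space ↔ (∀ j, j ∉ s → L.contVec j ⬝ᵥ b = 0) ∧
      ∀ k i j, lab k i = lab k j → L.levelVec k i ⬝ᵥ b = L.levelVec k j ⬝ᵥ b := by
  classical
  rw [mem_space]
  simp only [ofLabels, Set.mem_toFinset]
  refine and_congr Iff.rfl (forall_congr' fun k => forall_congr' fun i => forall_congr' fun j => ?_)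
  convert Iff.rfl using 2
  rw [← Setoid.ker_def (f := lab k)]
  convert Finpartition.mem_part_ofSetoid_iff_rel.symm

variable {M}

/-- The space of the minimal true model consists of the vectors that share all coincidences of the
parameter vector. -/
theorem IsMinimalTrue.mem_space_iff {β : L.Param → ℝ} (hM : M.IsMinimalTrue β)
    {b : L.Param → ℝ} :
    b ∈ M.space ↔ (∀ j, L.contVec j ⬝ᵥ β = 0 → L.contVec j ⬝ᵥ b = 0) ∧
      ∀ k i j, L.levelVec k i ⬝ᵥ β = L.levelVec k j ⬝ᵥ β →
        L.levelVec k i ⬝ᵥ b = L.levelVec k j ⬝ᵥ b := by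
  -- `N` imposes every coincidence of `β`, so its space lies in that of any model containing `β`;
  -- minimality of the dimension forces equality.
  let N : Model L := ofLabels {j | L.contVec j ⬝ᵥ β ≠ 0} (fun k i => L.levelVec k i ⬝ᵥ β)
  have hN : ∀ b, b ∈ N.space ↔ (∀ j, L.contVec j ⬝ᵥ β = 0 → L.contVec j ⬝ᵥ b = 0) ∧
      ∀ k i j, L.levelVec k i ⬝ᵥ β = L.levelVec k j ⬝ᵥ β →
        L.levelVec k i ⬝ᵥ b = L.levelVec k j ⬝ᵥ b := by
    intro b
    rw [mem_space_ofLabels]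
    simp
  have hβ := M.mem_space.1 hM.1
  have hle : N.space ≤ M.space := by
    intro b hb
    obtain ⟨h1, h2⟩ := (hN b).1 hb
    exact M.mem_space.2 ⟨fun j hj => h1 j (hβ.1 j hj), fun k i j hij => h2 k i j (hβ.2 k i j hij)⟩
  have heq := Submodule.eq_of_le_of_finrank_le hle
    (hM.2 N ((hN β).2 ⟨fun _ h => h, fun _ _ _ h => h⟩))
  rw [← heq, hN]

/-- The dimension of the kernel of a nonzero linear form. -/
theorem finrank_add_one_of_mem_iff {a : L.Param → ℝ} (ha : a ≠ 0)
    {V : Submodule ℝ (L.Param → ℝ)} (hV : ∀ b, b ∈ V ↔ a ⬝ᵥ b = 0) :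
    Module.finrank ℝ V + 1 = Fintype.card L.Param := by
  let φ : (L.Param → ℝ) →ₗ[ℝ] ℝ := dotProductBilin ℝ ℝ a
  have hφ : ∀ b, φ b = a ⬝ᵥ b := fun b => rfl
  have hVker : V = LinearMap.ker φ := by
    ext b
    rw [hV, LinearMap.mem_ker, hφ]
  have hφ0 : φ ≠ 0 := by
    intro h
    refine ha ((dotProduct_eq_zero_iff).1 fun b => ?_)
    rw [← hφ, h]
    rfl
  rw [hVker, Module.Dual.finrank_ker_add_one_of_ne_zero hφ0, Module.finrank_fintype_fun_eq_card]

theorem size_full : (full L).size = Fintype.card L.Param := by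
  have : (full L).space = ⊤ := by
    refine eq_top_iff.2 fun b _ => (mem_space _).2 ⟨fun j hj => ?_, fun k i j hij => ?_⟩
    · simp [full] at hj
    · have h : ({i} : Finset (L.Level k)) ∈ (((full L).part k).parts) := by
        simp [full]
      rw [((full L).part k).part_eq_of_mem h (Finset.mem_singleton_self i),
        Finset.mem_singleton] at hij
      rw [hij]
  rw [size, this, finrank_top, Module.finrank_fintype_fun_eq_card]

/-- The elementary constraints. -/
def IsElementary (a : L.Param → ℝ) : Prop :=
  (∃ j, a = L.contVec j) ∨ ∃ k i j, a = L.levelVec k i - L.levelVec k j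

/-- Each elementary constraint defines a feasible model. -/
theorem IsElementary.exists_model {a : L.Param → ℝ} (ha : IsElementary a) :
    ∃ M : Model L, ∀ b, b ∈ M.space ↔ a ⬝ᵥ b = 0 := by
  classical
  rcases ha with ⟨j, rfl⟩ | ⟨k, i, j, rfl⟩
  · refine ⟨ofLabels {j}ᶜ (fun k i => i), fun b => ?_⟩
    rw [mem_space_ofLabels]
    simp only [Set.mem_compl_iff, Set.mem_singleton_iff, not_not, forall_eq]
    exact and_iff_left fun k i j h => h ▸ rfl
  -- Relabelling `j` as `i` in factor `k` is the only identification. Labels in the sigma type keep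
  -- the other factors untouched without casts.
  · refine ⟨ofLabels Set.univ (fun k' x => if (⟨k', x⟩ : Σ k, L.Level k) = ⟨k, j⟩ then
      (⟨k, i⟩ : Σ k, L.Level k) else ⟨k', x⟩), fun b => ?_⟩
    rw [mem_space_ofLabels, sub_dotProduct, sub_eq_zero]
    simp only [Set.mem_univ, not_true_eq_false, false_implies, implies_true, true_and]
    constructor
    · intro h
      refine h k i j ?_
      simp
    · intro h k' x y hxy
      have hval : ∀ (k' : Fin L.numFactors) (x : L.Level k') (z : Σ k, L.Level k),
          (if (⟨k', x⟩ : Σ k, L.Level k) = ⟨k, j⟩ then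
            (⟨k, i⟩ : Σ k, L.Level k) else ⟨k', x⟩) = z →
          L.levelVec k' x ⬝ᵥ b = L.levelVec z.1 z.2 ⬝ᵥ b := by
        rintro k' x z rfl
        by_cases hx : (⟨k', x⟩ : Σ k, L.Level k) = ⟨k, j⟩
        · rw [if_pos hx]
          obtain ⟨rfl, hx⟩ := Sigma.mk.inj_iff.1 hx
          obtain rfl := eq_of_heq hx
          exact h.symm
        · rw [if_neg hx]
      rw [hval k' x _ hxy, ← hval k' y _ rfl]

end Model

/-! ### Least squares -/

section LeastSquares

variable {m ι : Type*} [Fintype m] [Fintype ι] {Z : Matrix m ι ℝ}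

theorem posDef_gram (hZ : Function.Injective Z.mulVec) : (Zᵀ * Z).PosDef := by
  have := Matrix.PosDef.conjTranspose_mul_self Z hZ
  rwa [Matrix.conjTranspose_eq_transpose_of_trivial] at this

variable [DecidableEq ι]

theorem isUnit_det_gram (hZ : Function.Injective Z.mulVec) : IsUnit (Zᵀ * Z).det :=
  (posDef_gram hZ).det_pos.ne'.isUnit

/-- The coefficients of the projection of `y` on the column space of `Z`. -/
noncomputable def lsq (Z : Matrix m ι ℝ) (y : m → ℝ) : ι → ℝ := (Zᵀ * Z)⁻¹ *ᵥ (Zᵀ *ᵥ y)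

theorem transpose_mulVec_lsq (hZ : Function.Injective Z.mulVec) (y : m → ℝ) :
    Zᵀ *ᵥ (Z *ᵥ lsq Z y) = Zᵀ *ᵥ y := by
  rw [lsq, Matrix.mulVec_mulVec, Matrix.mulVec_mulVec,
    Matrix.mul_nonsing_inv _ (isUnit_det_gram hZ), Matrix.one_mulVec]

theorem mulVec_dotProduct_sub_lsq (hZ : Function.Injective Z.mulVec) (y : m → ℝ) (u : ι → ℝ) :
    (Z *ᵥ u) ⬝ᵥ (y - Z *ᵥ lsq Z y) = 0 := by
  rw [dotProduct_comm, Matrix.dotProduct_mulVec, ← Matrix.mulVec_transpose, Matrix.mulVec_sub,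
    transpose_mulVec_lsq hZ, sub_self, zero_dotProduct]

theorem lsq_mulVec (hZ : Function.Injective Z.mulVec) (u : ι → ℝ) : lsq Z (Z *ᵥ u) = u := by
  rw [lsq, Matrix.mulVec_mulVec u, Matrix.mulVec_mulVec, Matrix.nonsing_inv_mul _
    (isUnit_det_gram hZ), Matrix.one_mulVec]

theorem lsq_add (y y' : m → ℝ) : lsq Z (y + y') = lsq Z y + lsq Z y' := by
  simp only [lsq, Matrix.mulVec_add]

/-- Pythagoras' theorem for the least squares residuals. -/
theorem dotProduct_self_sub_mulVec (hZ : Function.Injective Z.mulVec) (y : m → ℝ) (u : ι → ℝ) :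
    (y - Z *ᵥ u) ⬝ᵥ (y - Z *ᵥ u) = (y - Z *ᵥ lsq Z y) ⬝ᵥ (y - Z *ᵥ lsq Z y) +
      (Z *ᵥ (lsq Z y - u)) ⬝ᵥ (Z *ᵥ (lsq Z y - u)) := by
  have h := mulVec_dotProduct_sub_lsq hZ y (lsq Z y - u)
  have hsplit : y - Z *ᵥ u = (y - Z *ᵥ lsq Z y) + Z *ᵥ (lsq Z y - u) := by
    rw [Matrix.mulVec_sub]; abel
  rw [hsplit, add_dotProduct, dotProduct_add, dotProduct_add, h,
    dotProduct_comm (y - Z *ᵥ lsq Z y) (Z *ᵥ (lsq Z y - u)), h]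
  ring

theorem zero_le_dotProduct_self (v : m → ℝ) : 0 ≤ v ⬝ᵥ v :=
  Finset.sum_nonneg fun i _ => mul_self_nonneg (v i)

theorem dotProduct_sq_le (v w : m → ℝ) : (v ⬝ᵥ w) ^ 2 ≤ (v ⬝ᵥ v) * (w ⬝ᵥ w) := by
  have := Finset.sum_mul_sq_le_sq_mul_sq Finset.univ v w
  simpa only [dotProduct, sq] using this

/-- The Cauchy-Schwarz inequality for the quadratic form of the inverse Gram matrix. -/
theorem dotProduct_sq_le_gram (hZ : Function.Injective Z.mulVec) (a u : ι → ℝ) :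
    (a ⬝ᵥ u) ^ 2 ≤ (a ⬝ᵥ ((Zᵀ * Z)⁻¹ *ᵥ a)) * ((Z *ᵥ u) ⬝ᵥ (Z *ᵥ u)) := by
  have hdet := isUnit_det_gram hZ
  -- The vector Z(ZᵀZ)⁻¹a represents the form a on the column space. Taking w = (ZᵀZ)⁻¹a gives its
  -- squared length, and ordinary Cauchy-Schwarz applies.
  have h : ∀ w, (Z *ᵥ ((Zᵀ * Z)⁻¹ *ᵥ a)) ⬝ᵥ (Z *ᵥ w) = a ⬝ᵥ w := by
    intro w
    rw [Matrix.dotProduct_mulVec, ← Matrix.mulVec_transpose, Matrix.mulVec_mulVec,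
      Matrix.mulVec_mulVec, Matrix.mul_nonsing_inv _ hdet, Matrix.one_mulVec]
  have := dotProduct_sq_le (Z *ᵥ ((Zᵀ * Z)⁻¹ *ᵥ a)) (Z *ᵥ u)
  rwa [h, h] at this

theorem gram_inv_pos (hZ : Function.Injective Z.mulVec) {a : ι → ℝ} (ha : a ≠ 0) :
    0 < a ⬝ᵥ ((Zᵀ * Z)⁻¹ *ᵥ a) := by
  simpa using (posDef_gram hZ).inv.dotProduct_mulVec_pos ha

theorem gram_inv_nonneg (hZ : Function.Injective Z.mulVec) (a : ι → ℝ) :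
    0 ≤ a ⬝ᵥ ((Zᵀ * Z)⁻¹ *ᵥ a) := by
  by_cases ha : a = 0
  · simp [ha]
  · exact (gram_inv_pos hZ ha).le

end LeastSquares

/-! ### Least squares within a model and the loss of a single constraint. -/

section Estimation

variable {L : Layout} {n : ℕ} {D : Data L n}

theorem olsFull_eq_lsq (y : Fin n → ℝ) : olsFull D y = lsq D.X y := rfl

theorem rssOf_eq (y : Fin n → ℝ) (b : L.Param → ℝ) :
    rssOf D y b = (y - D.X *ᵥ b) ⬝ᵥ (y - D.X *ᵥ b) := by
  simp [rssOf, dotProduct, sq]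

theorem Z1_mulVec (M : Model L) (u : M.Free → ℝ) : Z1 D M *ᵥ u = D.X *ᵥ (M.A1 *ᵥ u) := by
  rw [Z1, Matrix.mulVec_mulVec]

theorem Z1_mulVec_injective (hX : Function.Injective D.X.mulVec) (M : Model L) :
    Function.Injective (Z1 D M).mulVec := by
  intro u u' h
  rw [Z1_mulVec, Z1_mulVec] at h
  exact M.A1_mulVec_injective (hX h)

theorem betaHat_eq (y : Fin n → ℝ) (M : Model L) :
    betaHat D y M = M.A1 *ᵥ lsq (Z1 D M) y := rfl

theorem betaHat_mem_space (y : Fin n → ℝ) (M : Model L) : betaHat D y M ∈ M.space :=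
  M.A1_mulVec_mem_space _

theorem rss_le (hX : Function.Injective D.X.mulVec) (y : Fin n → ℝ) (M : Model L)
    {b : L.Param → ℝ} (hb : b ∈ M.space) : rss D y M ≤ rssOf D y b := by
  obtain ⟨u, rfl⟩ := M.exists_A1_mulVec_eq hb
  rw [rss, rssOf_eq, rssOf_eq, betaHat_eq, ← Z1_mulVec, ← Z1_mulVec,
    dotProduct_self_sub_mulVec (Z1_mulVec_injective hX M) y u]
  exact le_add_of_nonneg_right (zero_le_dotProduct_self _)

theorem rssOf_eq_olsFull_add (hX : Function.Injective D.X.mulVec) (y : Fin n → ℝ)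
    (b : L.Param → ℝ) :
    rssOf D y b = rssOf D y (olsFull D y) +
      (D.X *ᵥ (olsFull D y - b)) ⬝ᵥ (D.X *ᵥ (olsFull D y - b)) := by
  rw [rssOf_eq, rssOf_eq, olsFull_eq_lsq]
  exact dotProduct_self_sub_mulVec hX y b

theorem hat_mulVec (M : Model L) (v : Fin n → ℝ) :
    hat D M *ᵥ v = Z1 D M *ᵥ lsq (Z1 D M) v := by
  simp only [hat, lsq, Matrix.mulVec_mulVec, Matrix.mul_assoc]

/-- The loss is the squared distance from Xβ to the image of the space of `M`. -/
theorem loss_le (hX : Function.Injective D.X.mulVec) (β : L.Param → ℝ) (M : Model L)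
    {b : L.Param → ℝ} (hb : b ∈ M.space) :
    loss D β M ≤ (D.X *ᵥ (β - b)) ⬝ᵥ (D.X *ᵥ (β - b)) := by
  obtain ⟨u, rfl⟩ := M.exists_A1_mulVec_eq hb
  have hZ := Z1_mulVec_injective hX M
  set v := D.X *ᵥ β with hv
  set w := v - Z1 D M *ᵥ lsq (Z1 D M) v with hw
  have h1 : loss D β M = w ⬝ᵥ w := by
    have hvw : v = w + Z1 D M *ᵥ lsq (Z1 D M) v := by rw [hw]; abel
    rw [loss, Matrix.sub_mulVec, Matrix.one_mulVec, hat_mulVec, ← hv, ← hw]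
    nth_rewrite 1 [hvw]
    rw [add_dotProduct, hw, mulVec_dotProduct_sub_lsq hZ, add_zero]
  rw [h1, Matrix.mulVec_sub, ← Z1_mulVec, ← hv, dotProduct_self_sub_mulVec hZ v u]
  exact le_add_of_nonneg_right (zero_le_dotProduct_self _)

/-- The loss of a false elementary constraint is at least the minimal loss. -/
theorem minLoss_le (hX : Function.Injective D.X.mulVec) {β : L.Param → ℝ} {T : Model L}
    (hT : β ∈ T.space) {a : L.Param → ℝ} (ha : Model.IsElementary a) (haβ : a ⬝ᵥ β ≠ 0) :
    minLoss D β T ≤ ENNReal.ofReal ((a ⬝ᵥ β) ^ 2 / (a ⬝ᵥ ((D.Xᵀ * D.X)⁻¹ *ᵥ a))) := by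
  obtain ⟨M, hM⟩ := ha.exists_model
  have ha0 : a ≠ 0 := by
    rintro rfl
    simp at haβ
  have hQ := gram_inv_pos hX ha0
  set Q := a ⬝ᵥ ((D.Xᵀ * D.X)⁻¹ *ᵥ a) with hQdef
  have hmem : M ∈ {M : Model L | M.size + 1 = (Model.full L).size ∧ ¬ T.space ≤ M.space} :=
    ⟨by rw [Model.size_full, Model.size, Model.finrank_add_one_of_mem_iff ha0 hM],
      fun h => haβ ((hM β).1 (h hT))⟩
  refine (iInf₂_le M hmem).trans (ENNReal.ofReal_le_ofReal ?_)
  -- This is the projection of `β` on the hyperplane of `a` in the metric of XᵀX; its squared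
  -- distance from `β` is (aᵀβ)²/Q.
  set b := β - ((a ⬝ᵥ β) / Q) • ((D.Xᵀ * D.X)⁻¹ *ᵥ a) with hb
  have hbM : b ∈ M.space := by
    rw [hM, hb, dotProduct_sub, dotProduct_smul, ← hQdef, smul_eq_mul, div_mul_cancel₀ _ hQ.ne',
      sub_self]
  refine (loss_le hX β M hbM).trans (le_of_eq ?_)
  have hG : (D.X *ᵥ ((D.Xᵀ * D.X)⁻¹ *ᵥ a)) ⬝ᵥ (D.X *ᵥ ((D.Xᵀ * D.X)⁻¹ *ᵥ a)) = Q := by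
    rw [Matrix.dotProduct_mulVec, ← Matrix.mulVec_transpose, Matrix.mulVec_mulVec,
      Matrix.mulVec_mulVec, Matrix.mul_nonsing_inv _ (isUnit_det_gram hX), Matrix.one_mulVec]
  rw [hb, sub_sub_cancel, Matrix.mulVec_smul, smul_dotProduct, dotProduct_smul, hG, smul_eq_mul,
    smul_eq_mul]
  field_simp

end Estimation

/-! ### The selected model for errors of moderate size -/

section Deterministic

variable {L : Layout} {n : ℕ} {D : Data L n} {β : L.Param → ℝ} {T : Model L} {e : Fin n → ℝ}
  {δ : ℝ}

theorem olsFull_response (hX : Function.Injective D.X.mulVec) :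
    olsFull D (D.X *ᵥ β + e) = β + olsFull D e := by
  rw [olsFull_eq_lsq, lsq_add, lsq_mulVec hX, olsFull_eq_lsq]

theorem rssOf_response : rssOf D (D.X *ᵥ β + e) β = e ⬝ᵥ e := by
  rw [rssOf_eq, add_sub_cancel_left]

/-- The squared length of the projection of the error vector on the column space of the model
matrix. -/
noncomputable def projSq (D : Data L n) (e : Fin n → ℝ) : ℝ :=
  (D.X *ᵥ olsFull D e) ⬝ᵥ (D.X *ᵥ olsFull D e)

theorem rssOf_olsFull_response (hX : Function.Injective D.X.mulVec) :
    rssOf D (D.X *ᵥ β + e) (olsFull D (D.X *ᵥ β + e)) = e ⬝ᵥ e - projSq D e := by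
  have h := rssOf_eq_olsFull_add hX (D.X *ᵥ β + e) β
  rw [rssOf_response, olsFull_response hX, add_sub_cancel_left] at h
  rw [olsFull_response hX, projSq]
  linarith

/-- A true constraint has a small test statistic. -/
theorem sq_olsFull_le (hX : Function.Injective D.X.mulVec) {a : L.Param → ℝ}
    (ha : a ⬝ᵥ β = 0) :
    (a ⬝ᵥ olsFull D (D.X *ᵥ β + e)) ^ 2 ≤ (a ⬝ᵥ ((D.Xᵀ * D.X)⁻¹ *ᵥ a)) * projSq D e := by
  rw [olsFull_response hX, dotProduct_add, ha, zero_add]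
  exact dotProduct_sq_le_gram hX a _

/-- A false elementary constraint has a large test statistic. -/
theorem le_sq_olsFull (hX : Function.Injective D.X.mulVec) (hT : β ∈ T.space)
    (hδ : ENNReal.ofReal δ ≤ minLoss D β T) (hδ0 : 0 < δ) (he : 16 * projSq D e ≤ δ)
    {a : L.Param → ℝ} (ha : Model.IsElementary a) (haβ : a ⬝ᵥ β ≠ 0) :
    9 / 16 * δ * (a ⬝ᵥ ((D.Xᵀ * D.X)⁻¹ *ᵥ a)) ≤ (a ⬝ᵥ olsFull D (D.X *ᵥ β + e)) ^ 2 := by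
  have ha0 : a ≠ 0 := by
    rintro rfl
    simp at haβ
  have hQ := gram_inv_pos hX ha0
  have h1 := hδ.trans (minLoss_le hX hT ha haβ)
  rw [ENNReal.ofReal_le_ofReal_iff (by positivity), le_div_iff₀ hQ] at h1
  have h2 := dotProduct_sq_le_gram hX a (olsFull D e)
  rw [← projSq] at h2
  rw [olsFull_response hX, dotProduct_add]
  set Q := a ⬝ᵥ ((D.Xᵀ * D.X)⁻¹ *ᵥ a)
  set x := a ⬝ᵥ β
  set z := a ⬝ᵥ olsFull D e
  have h3 : 16 * z ^ 2 ≤ δ * Q := by nlinarith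
  have h4 : |z| ≤ √(δ * Q) / 4 := by
    apply abs_le_of_sq_le_sq _ (by positivity)
    rw [div_pow, Real.sq_sqrt (by positivity)]
    linarith
  have h5 : √(δ * Q) ≤ |x| := by
    rw [← Real.sqrt_sq_eq_abs]
    exact Real.sqrt_le_sqrt h1
  have h6 : 3 / 4 * √(δ * Q) ≤ |x + z| := by
    have := abs_sub_abs_le_abs_sub x (-z)
    rw [abs_neg, sub_neg_eq_add] at this
    linarith
  calc 9 / 16 * δ * Q = (3 / 4 * √(δ * Q)) ^ 2 := by
        rw [mul_pow, Real.sq_sqrt (by positivity)]; ring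
    _ ≤ |x + z| ^ 2 := by gcongr
    _ = (x + z) ^ 2 := sq_abs _

theorem tSq_le (hX : Function.Injective D.X.mulVec) {S : ℝ}
    (hS : 0 < sigmaHatSq D (D.X *ᵥ β + e)) (he : 16 * projSq D e ≤ S)
    {a : L.Param → ℝ} (ha : a ⬝ᵥ β = 0) :
    tSq D (D.X *ᵥ β + e) a ≤ S / 16 / sigmaHatSq D (D.X *ᵥ β + e) := by
  have h := sq_olsFull_le (e := e) hX ha
  have hS0 : 0 ≤ projSq D e := zero_le_dotProduct_self _
  have hQ := gram_inv_nonneg hX a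
  rw [tSq, mul_comm (sigmaHatSq D _), ← div_div]
  refine div_le_div_of_nonneg_right ?_ hS.le
  -- Q may vanish: `a` = 0 occurs for the dissimilarity of a level with itself. The quotient is then
  -- 0.
  refine div_le_of_le_mul₀ hQ (by linarith) (h.trans ?_)
  nlinarith

theorem le_tSq (hX : Function.Injective D.X.mulVec) (hT : β ∈ T.space)
    (hδ : ENNReal.ofReal δ ≤ minLoss D β T) (hδ0 : 0 < δ) (he : 16 * projSq D e ≤ δ)
    (hS : 0 < sigmaHatSq D (D.X *ᵥ β + e))
    {a : L.Param → ℝ} (ha : Model.IsElementary a) (haβ : a ⬝ᵥ β ≠ 0) :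
    9 / 16 * δ / sigmaHatSq D (D.X *ᵥ β + e) ≤ tSq D (D.X *ᵥ β + e) a := by
  have ha0 : a ≠ 0 := by
    rintro rfl
    simp at haβ
  have hQ := gram_inv_pos hX ha0
  rw [tSq, mul_comm (sigmaHatSq D _), ← div_div]
  refine div_le_div_of_nonneg_right ?_ hS.le
  rw [le_div_iff₀ hQ]
  exact le_sq_olsFull hX hT hδ hδ0 he ha haβ

/-- A model with a false elementary constraint has a large residual sum of squares. -/
theorem rss_add_le_of_false (hX : Function.Injective D.X.mulVec) (hT : β ∈ T.space)
    (hδ : ENNReal.ofReal δ ≤ minLoss D β T) (hδ0 : 0 < δ) (he : 16 * projSq D e ≤ δ)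
    {a : L.Param → ℝ} (ha : Model.IsElementary a) (haβ : a ⬝ᵥ β ≠ 0) {M : Model L}
    (hM : ∀ b ∈ M.space, a ⬝ᵥ b = 0) :
    rss D (D.X *ᵥ β + e) T + δ / 2 ≤ rss D (D.X *ᵥ β + e) M := by
  set y := D.X *ᵥ β + e with hy
  have ha0 : a ≠ 0 := by
    rintro rfl
    simp at haβ
  have hQ := gram_inv_pos hX ha0
  have h1 : rss D y T ≤ e ⬝ᵥ e := by
    rw [← rssOf_response (D := D) (β := β)]
    exact rss_le hX _ T hT
  have h2 := rssOf_eq_olsFull_add hX y (betaHat D y M)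
  rw [← rss, hy, rssOf_olsFull_response hX, ← hy] at h2
  -- The estimator in `M` satisfies the false constraint, so its distance from the full estimator is
  -- at least 9δ/16; subtracting W ≤ δ/16 leaves δ/2.
  have h3 := dotProduct_sq_le_gram hX a (olsFull D y - betaHat D y M)
  rw [dotProduct_sub, hM _ (betaHat_mem_space y M), sub_zero] at h3
  have h4 := (le_sq_olsFull hX hT hδ hδ0 he ha haβ).trans h3
  rw [mul_comm] at h4
  have h5 := le_of_mul_le_mul_left h4 hQ
  linarith

theorem isElementary_stepVec (y : Fin n → ℝ) (c : ∀ k, Clustering (dissim D y k)) (s : L.Step) :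
    Model.IsElementary (stepVec D y c s) := by
  rcases s with j | q
  · exact Or.inl ⟨j, rfl⟩
  · exact Or.inr ⟨_, _, _, rfl⟩

/-- Conditions under which the procedure recovers the true model: the projection of the error vector
is small compared with the penalty and with the losses, and the error vector is neither too
short nor too long. -/
structure Recovers (D : Data L n) (β : L.Param → ℝ) (T : Model L) (r δ c C : ℝ)
    (e : Fin n → ℝ) : Prop where
  c_pos : 0 < c
  C_pos : 0 < C
  δ_pos : 0 < δ
  δ_le : δ ≤ n
  δ_le_minLoss : ENNReal.ofReal δ ≤ minLoss D β T
  params_lt : L.numParams < n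
  proj_le : 16 * projSq D e ≤ δ
  proj_lt : projSq D e < c * r
  le_rss : c * n ≤ e ⬝ᵥ e - projSq D e
  le_mul : e ⬝ᵥ e ≤ C * n
  penalty_lt : r * T.size < δ / (2 * C + 1)

variable {r c C : ℝ}

theorem Recovers.penalty_pos (h : Recovers D β T r δ c C e) : 0 < r := by
  have h0 : 0 ≤ projSq D e := zero_le_dotProduct_self _
  exact pos_of_mul_pos_right (h0.trans_lt h.proj_lt) h.c_pos.le

theorem Recovers.n_pos (h : Recovers D β T r δ c C e) : (0 : ℝ) < n :=
  Nat.cast_pos.2 ((Nat.zero_le _).trans_lt h.params_lt)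

theorem Recovers.le_rss_model (hX : Function.Injective D.X.mulVec)
    (h : Recovers D β T r δ c C e) (M : Model L) : c * n ≤ rss D (D.X *ᵥ β + e) M := by
  refine h.le_rss.trans ?_
  rw [← rssOf_olsFull_response (β := β) hX, rss, rssOf_eq_olsFull_add hX _ (betaHat D _ M)]
  exact le_add_of_nonneg_right (zero_le_dotProduct_self _)

theorem Recovers.sigmaHatSq_pos (hX : Function.Injective D.X.mulVec)
    (h : Recovers D β T r δ c C e) : 0 < sigmaHatSq D (D.X *ᵥ β + e) := by
  have hn := h.n_pos
  have hc := h.c_pos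
  rw [sigmaHatSq, rssOf_olsFull_response hX]
  refine div_pos (lt_of_lt_of_le (by positivity) h.le_rss) (sub_pos.2 ?_)
  exact_mod_cast h.params_lt

/-- Larger models than the true one have a larger criterion. -/
theorem Recovers.gic_lt_of_lt (hX : Function.Injective D.X.mulVec)
    (h : Recovers D β T r δ c C e) (hT : β ∈ T.space) {M : Model L} (hM : T.space < M.space) :
    gic D (D.X *ᵥ β + e) r T < gic D (D.X *ᵥ β + e) r M := by
  have hn := h.n_pos
  have hc := h.c_pos
  have hr := h.penalty_pos
  have hMpos := h.le_rss_model hX M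
  have hTpos := h.le_rss_model hX T
  have hcn : 0 < c * n := by positivity
  have hTM : rss D (D.X *ᵥ β + e) T - rss D (D.X *ᵥ β + e) M ≤ projSq D e := by
    have h1 : rss D (D.X *ᵥ β + e) T ≤ e ⬝ᵥ e := by
      rw [← rssOf_response (D := D) (β := β)]
      exact rss_le hX _ T hT
    have h2 : e ⬝ᵥ e - projSq D e ≤ rss D (D.X *ᵥ β + e) M := by
      rw [← rssOf_olsFull_response (β := β) hX, rss, rssOf_eq_olsFull_add hX _ (betaHat D _ M)]
      exact le_add_of_nonneg_right (zero_le_dotProduct_self _)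
    linarith
  have hsize : (T.size : ℝ) + 1 ≤ M.size := by
    exact_mod_cast Submodule.finrank_lt_finrank_of_lt hM
  rw [gic, gic]
  set RT := rss D (D.X *ᵥ β + e) T
  set RM := rss D (D.X *ᵥ β + e) M
  have hRT : 0 < RT := hcn.trans_le hTpos
  have hRM : 0 < RM := hcn.trans_le hMpos
  have hlog := Real.log_le_sub_one_of_pos (div_pos hRT hRM)
  rw [Real.log_div hRT.ne' hRM.ne'] at hlog
  have hW0 : 0 ≤ projSq D e := zero_le_dotProduct_self _
  -- The two RSS differ by at most W, and `RM` ≥ cn, so the gain is at most W/c < r.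
  have h1 : n * (RT / RM - 1) < r := by
    have h2 : RT / RM - 1 = (RT - RM) / RM := by field_simp
    rw [h2]
    calc n * ((RT - RM) / RM) ≤ n * (projSq D e / (c * n)) := by gcongr
      _ = projSq D e / c := by field_simp
      _ < r := by rw [div_lt_iff₀ hc]; linarith [h.proj_lt]
  have h2 : n * (Real.log RT - Real.log RM) ≤ n * (RT / RM - 1) := by gcongr
  nlinarith

/-- Models with a false elementary constraint have a larger criterion than the true one. -/
theorem Recovers.gic_lt_of_false (hX : Function.Injective D.X.mulVec)
    (h : Recovers D β T r δ c C e) (hT : β ∈ T.space) {a : L.Param → ℝ}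
    (ha : Model.IsElementary a) (haβ : a ⬝ᵥ β ≠ 0) {M : Model L}
    (hM : ∀ b ∈ M.space, a ⬝ᵥ b = 0) :
    gic D (D.X *ᵥ β + e) r T < gic D (D.X *ᵥ β + e) r M := by
  have hn := h.n_pos
  have hc := h.c_pos
  have hC := h.C_pos
  have hδ := h.δ_pos
  have hr := h.penalty_pos
  have hTpos := h.le_rss_model hX T
  have hRM := rss_add_le_of_false hX hT h.δ_le_minLoss hδ h.proj_le ha haβ hM
  have hRTC : rss D (D.X *ᵥ β + e) T ≤ C * n := by
    refine le_trans ?_ h.le_mul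
    rw [← rssOf_response (D := D) (β := β)]
    exact rss_le hX _ T hT
  rw [gic, gic]
  set RT := rss D (D.X *ᵥ β + e) T
  set RM := rss D (D.X *ᵥ β + e) M
  have hRT : 0 < RT := lt_of_lt_of_le (by positivity) hTpos
  have hRM0 : 0 < RM := by linarith
  have hlog := Real.log_le_sub_one_of_pos (div_pos hRT hRM0)
  rw [Real.log_div hRT.ne' hRM0.ne'] at hlog
  -- The constant comes from 2 `RT` + δ ≤ 2Cn + n.
  have h1 : δ / (2 * C + 1) ≤ n * (1 - RT / RM) := by
    have h2 : RT / RM ≤ RT / (RT + δ / 2) := by gcongr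
    have h3 : 1 - RT / (RT + δ / 2) = δ / (2 * RT + δ) := by field_simp; ring
    have h4 : 2 * RT + δ ≤ (2 * C + 1) * n := by linarith [h.δ_le]
    calc δ / (2 * C + 1) = n * (δ / ((2 * C + 1) * n)) := by field_simp
      _ ≤ n * (δ / (2 * RT + δ)) := by gcongr
      _ ≤ n * (1 - RT / RM) := by rw [← h3]; gcongr
  have h2 : n * (Real.log RT - Real.log RM) ≤ n * (RT / RM - 1) := by gcongr
  have h3 : 0 ≤ r * (M.size : ℝ) := by positivity
  have h4 := h.penalty_lt
  linarith

/-- Under the conditions `Recovers` the procedure selects the true model. -/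
theorem Recovers.eq_of_isOutput (hX : Function.Injective D.X.mulVec)
    (h : Recovers D β T r δ c C e) (hT : T.IsMinimalTrue β) {M : Model L}
    (hM : IsOutput D (D.X *ᵥ β + e) r M) : M = T := by
  classical
  have hδ := h.δ_pos
  have hS := h.sigmaHatSq_pos hX
  have hle : ∀ a : L.Param → ℝ, a ⬝ᵥ β = 0 →
      tSq D (D.X *ᵥ β + e) a ≤ δ / 16 / sigmaHatSq D (D.X *ᵥ β + e) := fun a ha =>
    tSq_le hX hS h.proj_le ha
  have hge : ∀ a : L.Param → ℝ, Model.IsElementary a → a ⬝ᵥ β ≠ 0 →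
      9 / 16 * δ / sigmaHatSq D (D.X *ᵥ β + e) ≤ tSq D (D.X *ᵥ β + e) a :=
    fun a ha haβ => le_tSq hX hT.1 h.δ_le_minLoss hδ h.proj_le hS ha haβ
  have hlarge : ∀ M : Model L, T.space < M.space →
      gic D (D.X *ᵥ β + e) r T < gic D (D.X *ᵥ β + e) r M := fun M hM =>
    h.gic_lt_of_lt hX hT.1 hM
  have hwrong : ∀ a : L.Param → ℝ, Model.IsElementary a → a ⬝ᵥ β ≠ 0 → ∀ M : Model L,
      (∀ b ∈ M.space, a ⬝ᵥ b = 0) →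
      gic D (D.X *ᵥ β + e) r T < gic D (D.X *ᵥ β + e) r M := fun a ha haβ M hM =>
    h.gic_lt_of_false hX hT.1 ha haβ hM
  -- From here on the response enters only through the separation of the statistics and the two
  -- comparisons of the criterion.
  generalize D.X *ᵥ β + e = y at hM hS hle hge hlarge hwrong
  obtain ⟨cl, σ, path, hmono, hpath, m, rfl, hmin⟩ := hM
  set lo := δ / 16 / sigmaHatSq D y with hlo
  set hi := 9 / 16 * δ / sigmaHatSq D y with hhi
  have hlohi : lo < hi := by
    rw [hlo, hhi]
    gcongr
    linarith
  have hsep : ∀ k, Clustering.Separates (dissim D y k) (fun i => L.levelVec k i ⬝ᵥ β) lo hi := by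
    intro k i j
    refine ⟨fun hij => hle _ ?_, fun hij => hge _ (Or.inr ⟨k, i, j, rfl⟩) ?_⟩
    · rw [sub_dotProduct, sub_eq_zero]
      exact hij
    · rw [sub_dotProduct, sub_ne_zero]
      exact hij
  have hdich : ∀ s, (stepHeight D y cl s ≤ lo ∧ stepVec D y cl s ⬝ᵥ β = 0) ∨
      (hi ≤ stepHeight D y cl s ∧ stepVec D y cl s ⬝ᵥ β ≠ 0) := by
    rintro (j | ⟨k, s⟩)
    · by_cases hj : L.contVec j ⬝ᵥ β = 0
      · exact Or.inl ⟨hle _ hj, hj⟩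
      · exact Or.inr ⟨hge _ (Or.inl ⟨j, rfl⟩) hj, hj⟩
    · have := (cl k).height_dichotomy hlohi (hsep k) s.2
      simpa only [stepHeight, stepVec, sub_dotProduct, sub_eq_zero, sub_ne_zero, ne_eq] using this
  -- The true constraints among those produced by the procedure already define T: low steps are
  -- true, and they generate all equalities between levels.
  have hTiff : ∀ b, b ∈ T.space ↔ ∀ s, stepVec D y cl s ⬝ᵥ β = 0 → stepVec D y cl s ⬝ᵥ b = 0 := by
    intro b
    rw [hT.mem_space_iff]
    constructor
    · rintro ⟨hc, hl⟩ (j | ⟨k, s⟩) hs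
      · exact hc j hs
      · rw [stepVec, sub_dotProduct, sub_eq_zero] at hs ⊢
        exact hl _ _ _ hs
    · intro hb
      refine ⟨fun j hj => hb (Sum.inl j) hj, fun k i j hij => ?_⟩
      refine (cl k).eq_of_low_steps (g := fun i => L.levelVec k i ⬝ᵥ b) hlohi (hsep k) ?_ hij
      intro s hs hslo
      rcases hdich (Sum.inr ⟨k, ⟨s, hs⟩⟩) with hd | hd
      · have := hb _ hd.2
        rwa [stepVec, sub_dotProduct, sub_eq_zero] at this
      · exact absurd (hd.1.trans hslo) (not_le.2 hlohi)
  let N := Fintype.card L.Step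
  have hdown : ∀ i j : Fin N, stepVec D y cl (σ i) ⬝ᵥ β ≠ 0 → stepVec D y cl (σ j) ⬝ᵥ β = 0 →
      j < i := by
    intro i j hi' hj
    by_contra! hij
    have h1 : hi ≤ stepHeight D y cl (σ i) := (hdich (σ i)).elim (fun h => absurd h.2 hi') (·.1)
    have h2 : stepHeight D y cl (σ j) ≤ lo := (hdich (σ j)).elim (·.1) (fun h => absurd hj h.2)
    have h3 := hmono hij
    simp only at h3
    linarith
  have hfalse : ∀ m : Fin (N + 1), (∃ i : Fin N, (i : ℕ) < (m : ℕ) ∧ stepVec D y cl (σ i) ⬝ᵥ β ≠ 0) →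
      gic D y r T < gic D y r (path m) := by
    rintro m ⟨i, him, hi'⟩
    exact hwrong _ (isElementary_stepVec y cl (σ i)) hi' _
      fun b hb => (hpath m b).1 hb i him
  have htrue : ∀ m : Fin (N + 1), (∀ i : Fin N, (i : ℕ) < (m : ℕ) → stepVec D y cl (σ i) ⬝ᵥ β = 0) →
      T.space ≤ (path m).space := fun m hm b hb =>
    (hpath m b).2 fun i hi' => (hTiff b).1 hb _ (hm i hi')
  obtain ⟨m₀, hm₀⟩ : ∃ m₀, (path m₀).space = T.space := by
    -- Sorting puts the true constraints before the false ones, so the first `m₀` constraints, with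
    -- `m₀` their number, are exactly the true ones.
    let m₀ : ℕ := (Finset.univ.filter fun i : Fin N => stepVec D y cl (σ i) ⬝ᵥ β = 0).card
    have hm₀ : m₀ < N + 1 := Nat.lt_succ_of_le ((Finset.card_le_univ _).trans (by simp))
    have hiff : ∀ i : Fin N, (i : ℕ) < m₀ ↔ stepVec D y cl (σ i) ⬝ᵥ β = 0 := by
      intro i
      by_cases hi' : stepVec D y cl (σ i) ⬝ᵥ β = 0
      · refine iff_of_true ?_ hi'
        have hsub : Finset.Iic i ⊆
            Finset.univ.filter fun i : Fin N => stepVec D y cl (σ i) ⬝ᵥ β = 0 := by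
          intro j hj
          rw [Finset.mem_filter]
          refine ⟨Finset.mem_univ j, ?_⟩
          by_contra hj'
          exact absurd (Finset.mem_Iic.1 hj) (not_le.2 (hdown j i hj' hi'))
        have := Finset.card_le_card hsub
        rw [Fin.card_Iic] at this
        exact this
      · refine iff_of_false ?_ hi'
        have hsub : (Finset.univ.filter fun i : Fin N => stepVec D y cl (σ i) ⬝ᵥ β = 0) ⊆
            Finset.Iio i := by
          intro j hj
          exact Finset.mem_Iio.2 (hdown i j hi' (Finset.mem_filter.1 hj).2)
        have := Finset.card_le_card hsub
        rw [Fin.card_Iio] at this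
        exact not_lt.2 this
    refine ⟨⟨m₀, hm₀⟩, Submodule.ext fun b => ?_⟩
    rw [hpath, hTiff]
    constructor
    · intro hb s hs
      have := hb (σ.symm s)
      rw [Equiv.apply_symm_apply] at this
      exact this ((hiff _).2 (by rwa [Equiv.apply_symm_apply]))
    · intro hb i hi'
      exact hb _ ((hiff i).1 hi')
  have hgT : gic D y r (path m) ≤ gic D y r T := by
    rw [← Model.space_injective hm₀]
    exact hmin m₀
  have hm : ∀ i : Fin N, (i : ℕ) < (m : ℕ) → stepVec D y cl (σ i) ⬝ᵥ β = 0 := by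
    by_contra! hcon
    exact absurd hgT (not_le.2 (hfalse m hcon))
  refine Model.space_injective ((htrue m hm).eq_or_lt.elim (·.symm) fun hlt => ?_)
  exact absurd hgT (not_le.2 (hlarge _ hlt))

end Deterministic

/-! ### Gaussian errors -/

section Gaussian

variable {n : ℕ} {v : ℝ≥0}

/-- The finite fourth moment is what Chebyshev's inequality for the squared length needs. -/
theorem memLp_sq_gaussianReal : MemLp (fun x : ℝ => x ^ 2) 2 (gaussianReal 0 v) := by
  rw [memLp_two_iff_integrable_sq (by fun_prop)]
  have h := (memLp_id_gaussianReal (μ := 0) (v := v) 4).integrable_norm_pow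
    (p := 4) (by norm_num)
  refine h.congr (Eventually.of_forall fun x => ?_)
  simp only [id, Real.norm_eq_abs]
  rw [← pow_mul, ← abs_pow, abs_of_nonneg (by positivity)]

theorem memLp_two_linear (w : Fin n → ℝ) :
    MemLp (fun e => w ⬝ᵥ e) 2 (Measure.pi fun _ : Fin n => gaussianReal 0 v) := by
  refine memLp_finsetSum _ fun i _ => ?_
  have h : MemLp (fun x : ℝ => w i * x) 2 (gaussianReal 0 v) :=
    (memLp_id_gaussianReal (μ := 0) (v := v) 2).const_mul (w i)
  exact h.comp_measurePreserving (measurePreserving_eval (fun _ : Fin n => gaussianReal 0 v) i)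

theorem integral_sq_linear (w : Fin n → ℝ) :
    ∫ e, (w ⬝ᵥ e) ^ 2 ∂(Measure.pi fun _ : Fin n => gaussianReal 0 v) = v * (w ⬝ᵥ w) := by
  have hmean : ∫ e, w ⬝ᵥ e ∂(Measure.pi fun _ : Fin n => gaussianReal 0 v) = 0 := by
    simp only [dotProduct]
    rw [integral_finsetSum]
    · refine Finset.sum_eq_zero fun i _ => ?_
      have h : ∫ e, e i ∂(Measure.pi fun _ : Fin n => gaussianReal 0 v) =
          ∫ x, x ∂(gaussianReal 0 v) :=
        integral_comp_eval (μ := fun _ : Fin n => gaussianReal 0 v) (i := i) (f := fun x : ℝ => x)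
          (by fun_prop)
      rw [integral_const_mul, h, integral_id_gaussianReal, mul_zero]
    · intro i _
      refine Integrable.const_mul ?_ _
      exact integrable_comp_eval (μ := fun _ : Fin n => gaussianReal 0 v) (i := i) (f := fun x : ℝ => x)
        ((memLp_id_gaussianReal (μ := 0) (v := v) 1).integrable (by simp))
  rw [← variance_of_integral_eq_zero (memLp_two_linear w).aestronglyMeasurable.aemeasurable hmean]
  have hsum : (fun e : Fin n → ℝ => w ⬝ᵥ e) = ∑ i, fun e : Fin n → ℝ => (fun x => w i * x) (e i) := by
    funext e
    simp [dotProduct]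
  rw [hsum, variance_sum_pi (X := fun i x => w i * x)]
  · rw [dotProduct, Finset.mul_sum]
    refine Finset.sum_congr rfl fun i _ => ?_
    rw [variance_const_mul, variance_fun_id_gaussianReal]
    ring
  · exact fun i => (memLp_id_gaussianReal (μ := 0) (v := v) 2).const_mul (w i)

/-- Concentration of the squared length of a Gaussian vector. -/
theorem measure_dotProduct_self_le {c : ℝ} (hc : 0 < c) :
    (Measure.pi fun _ : Fin n => gaussianReal 0 v) {e | c ≤ |e ⬝ᵥ e - n * v|} ≤
      ENNReal.ofReal (n * Var[fun x => x ^ 2; gaussianReal 0 v] / c ^ 2) := by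
  have hsum : (fun e : Fin n → ℝ => e ⬝ᵥ e) = ∑ i, fun e : Fin n → ℝ => (fun x => x ^ 2) (e i) := by
    funext e
    simp [dotProduct, sq]
  have hmem : MemLp (fun e : Fin n → ℝ => e ⬝ᵥ e) 2
      (Measure.pi fun _ : Fin n => gaussianReal 0 v) := by
    rw [hsum]
    refine memLp_finsetSum' _ fun i _ => ?_
    exact memLp_sq_gaussianReal.comp_measurePreserving
      (measurePreserving_eval (fun _ : Fin n => gaussianReal 0 v) i)
  have hmean : ∫ e, e ⬝ᵥ e ∂(Measure.pi fun _ : Fin n => gaussianReal 0 v) = n * v := by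
    have h1 : ∀ e : Fin n → ℝ, e ⬝ᵥ e = ∑ i, (Pi.single i 1 ⬝ᵥ e) ^ 2 := by
      intro e
      simp only [single_one_dotProduct]
      simp [dotProduct, sq]
    simp_rw [h1]
    rw [integral_finsetSum]
    · rw [Finset.sum_congr rfl fun i _ => integral_sq_linear _]
      simp
    · exact fun i _ => (memLp_two_linear _).integrable_sq
  have hvar : Var[fun e : Fin n → ℝ => e ⬝ᵥ e; Measure.pi fun _ : Fin n => gaussianReal 0 v] =
      n * Var[fun x => x ^ 2; gaussianReal 0 v] := by
    rw [hsum, variance_sum_pi (X := fun _ x => x ^ 2) fun _ => memLp_sq_gaussianReal]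
    simp
  have := meas_ge_le_variance_div_sq hmem hc
  rwa [hmean, hvar] at this

variable {L : Layout} {D : Data L n}

/-- The projection matrix H is symmetric and idempotent, so this is tr H = p. It is also the sum of
the squared lengths of the rows of H, hence gives the mean of `projSq`. -/
theorem trace_hat_sq (hX : Function.Injective D.X.mulVec) :
    Matrix.trace ((D.X * (D.Xᵀ * D.X)⁻¹ * D.Xᵀ) * (D.X * (D.Xᵀ * D.X)⁻¹ * D.Xᵀ)ᵀ) =
      L.numParams := by
  have hdet := isUnit_det_gram hX
  have hsymm : (D.X * (D.Xᵀ * D.X)⁻¹ * D.Xᵀ)ᵀ = D.X * (D.Xᵀ * D.X)⁻¹ * D.Xᵀ := by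
    rw [Matrix.transpose_mul, Matrix.transpose_mul, Matrix.transpose_transpose,
      Matrix.transpose_nonsing_inv, Matrix.transpose_mul, Matrix.transpose_transpose,
      Matrix.mul_assoc]
  have hidem : (D.X * (D.Xᵀ * D.X)⁻¹ * D.Xᵀ) * (D.X * (D.Xᵀ * D.X)⁻¹ * D.Xᵀ) =
      D.X * ((D.Xᵀ * D.X)⁻¹ * D.Xᵀ) := by
    calc _ = D.X * ((D.Xᵀ * D.X)⁻¹ * (D.Xᵀ * D.X)) * ((D.Xᵀ * D.X)⁻¹ * D.Xᵀ) := by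
          simp only [Matrix.mul_assoc]
      _ = _ := by rw [Matrix.nonsing_inv_mul _ hdet, Matrix.mul_one]
  rw [hsymm, hidem, Matrix.trace_mul_comm, Matrix.mul_assoc, Matrix.nonsing_inv_mul _ hdet,
    Matrix.trace_one, Layout.numParams]

theorem projSq_eq_sum (e : Fin n → ℝ) :
    projSq D e = ∑ i, ((D.X * (D.Xᵀ * D.X)⁻¹ * D.Xᵀ).row i ⬝ᵥ e) ^ 2 := by
  rw [projSq, olsFull, Matrix.mulVec_mulVec, Matrix.mulVec_mulVec]
  simp [dotProduct, Matrix.mulVec, sq]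

theorem measurable_projSq : Measurable (projSq D) := by
  have : projSq D = fun e => ∑ i, ((D.X * (D.Xᵀ * D.X)⁻¹ * D.Xᵀ).row i ⬝ᵥ e) ^ 2 :=
    funext projSq_eq_sum
  rw [this]
  simp only [dotProduct]
  fun_prop

theorem integrable_projSq :
    Integrable (projSq D) (Measure.pi fun _ : Fin n => gaussianReal 0 v) := by
  have : projSq D = fun e => ∑ i, ((D.X * (D.Xᵀ * D.X)⁻¹ * D.Xᵀ).row i ⬝ᵥ e) ^ 2 :=
    funext projSq_eq_sum
  rw [this]
  exact integrable_finsetSum _ fun i _ => (memLp_two_linear _).integrable_sq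

theorem integral_projSq (hX : Function.Injective D.X.mulVec) :
    ∫ e, projSq D e ∂(Measure.pi fun _ : Fin n => gaussianReal 0 v) = v * L.numParams := by
  simp_rw [projSq_eq_sum]
  rw [integral_finsetSum _ fun i _ => (memLp_two_linear _).integrable_sq, ← trace_hat_sq hX]
  simp_rw [integral_sq_linear, ← Finset.mul_sum]
  rfl

theorem measure_projSq_le (hX : Function.Injective D.X.mulVec) {c : ℝ} (hc : 0 < c) :
    (Measure.pi fun _ : Fin n => gaussianReal 0 v) {e | c ≤ projSq D e} ≤
      ENNReal.ofReal (v * L.numParams / c) := by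
  have h := mul_meas_ge_le_integral_of_nonneg
    (μ := Measure.pi fun _ : Fin n => gaussianReal 0 v) (f := projSq D)
    (Eventually.of_forall fun e => zero_le_dotProduct_self _) integrable_projSq c
  rw [integral_projSq hX, mul_comm, ← le_div_iff₀ hc] at h
  rw [← ofReal_measureReal]
  exact ENNReal.ofReal_le_ofReal h

end Gaussian

theorem mulVec_injective_of_rank {L : Layout} {n : ℕ} {D : Data L n}
    (h : D.X.rank = L.numParams) : Function.Injective D.X.mulVec := by
  rw [Matrix.mulVec_injective_iff, linearIndependent_iff_card_eq_finrank_span]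
  rw [Matrix.rank_eq_finrank_span_cols, Layout.numParams] at h
  exact h.symm

/-! ### Consistency of the selection -/

theorem Layout.numParams_pos (L : Layout) : 0 < L.numParams := Fintype.card_pos

/-- Requiring `f n` ≠ 0 excludes the convention 0 / 0 = 0, under which the strict inequality would
fail; `g n` = ∞ is allowed. -/
theorem Prec.eventually_lt {f g : ℕ → ℝ≥0∞} (h : Prec f g) (hf0 : ∀ᶠ n in atTop, f n ≠ 0)
    (hf : ∀ n, f n ≠ ∞) {η : ℝ} (hη : 0 < η) :
    ∀ᶠ n in atTop, f n < ENNReal.ofReal η * g n := by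
  filter_upwards [h.eventually_lt_const (ENNReal.ofReal_pos.2 hη), hf0] with n hn hn0
  exact (ENNReal.div_lt_iff (Or.inr hn0) (Or.inr (hf n))).1 hn

section Consistency

variable {Ω : ℕ → Type*} [∀ n, MeasurableSpace (Ω n)] {P : ∀ n, Measure (Ω n)}
  {L : ℕ → Layout} {D : ∀ n, Data (L n) n} {β : ∀ n, (L n).Param → ℝ} {T : ∀ n, Model (L n)}
  {σ : ℝ} {ε : ∀ n, Ω n → Fin n → ℝ} {r : ℕ → ℝ} {That : ∀ n, Ω n → Model (L n)}

/-- The smaller of the sample size and the minimal loss. -/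
noncomputable def signal (D : ∀ n, Data (L n) n) (β : ∀ n, (L n).Param → ℝ)
    (T : ∀ n, Model (L n)) (n : ℕ) : ℝ :=
  (min (n : ℝ≥0∞) (minLoss (D n) (β n) (T n))).toReal

theorem ofReal_signal (n : ℕ) :
    ENNReal.ofReal (signal D β T n) = min (n : ℝ≥0∞) (minLoss (D n) (β n) (T n)) :=
  ENNReal.ofReal_toReal (min_lt_of_left_lt (ENNReal.natCast_lt_top n)).ne

theorem signal_le (n : ℕ) : signal D β T n ≤ n := by
  have h : ENNReal.ofReal (signal D β T n) ≤ ENNReal.ofReal n := by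
    rw [ofReal_signal, ENNReal.ofReal_natCast]
    exact min_le_left _ _
  rwa [ENNReal.ofReal_le_ofReal_iff (Nat.cast_nonneg n)] at h

namespace Setting

theorem eventually_params_lt (h : Setting P L D β T σ ε r That) :
    ∀ᶠ n in atTop, ((L n).numParams : ℝ) < r n := by
  filter_upwards [h.params_prec.eventually_lt
    (Eventually.of_forall fun n => Nat.cast_ne_zero.2 (L n).numParams_pos.ne')
    (fun _ => ENNReal.natCast_ne_top _) one_pos] with n hn
  rw [ENNReal.ofReal_one, one_mul, ← ENNReal.ofReal_natCast] at hn
  exact (ENNReal.ofReal_lt_ofReal_iff_of_nonneg (Nat.cast_nonneg _)).1 hn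

theorem eventually_penalty_pos (h : Setting P L D β T σ ε r That) :
    ∀ᶠ n in atTop, 0 < r n := by
  filter_upwards [h.eventually_params_lt] with n hn
  exact (Nat.cast_nonneg _).trans_lt hn

theorem eventually_penalty_lt (h : Setting P L D β T σ ε r That) {η : ℝ} (hη : 0 < η) :
    ∀ᶠ n in atTop, r n < η * signal D β T n := by
  filter_upwards [h.penalty_prec.eventually_lt
    (h.eventually_penalty_pos.mono fun n hr => (ENNReal.ofReal_pos.2 hr).ne')
    (fun _ => ENNReal.ofReal_ne_top) hη, h.eventually_penalty_pos] with n hn hr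
  rw [← ofReal_signal, ← ENNReal.ofReal_mul hη.le] at hn
  exact (ENNReal.ofReal_lt_ofReal_iff_of_nonneg hr.le).1 hn

/-- For large samples, errors of moderate size lead to the true model. -/
theorem eventually_recovers (h : Setting P L D β T σ ε r That) :
    ∀ᶠ n in atTop, ∀ e : Fin n → ℝ, projSq (D n) e < σ ^ 2 / 4 * r n →
      |e ⬝ᵥ e - n * σ ^ 2| < n * σ ^ 2 / 2 →
      Recovers (D n) (β n) (T n) (r n) (signal D β T n) (σ ^ 2 / 4) (2 * σ ^ 2) e := by
  obtain ⟨K, hK⟩ := h.true_size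
  have hσ : 0 < σ ^ 2 := pow_pos h.sigma_pos 2
  have hK1 : (0 : ℝ) < K + 1 := by positivity
  filter_upwards [h.eventually_params_lt, h.eventually_penalty_lt one_pos,
    h.eventually_penalty_lt (η := (4 * σ ^ 2)⁻¹) (by positivity),
    h.eventually_penalty_lt (η := ((K + 1) * (2 * (2 * σ ^ 2) + 1))⁻¹) (by positivity)]
    with n hp h1 h2 h3 e hW hE
  rw [one_mul] at h1
  have hp0 : (0 : ℝ) < (L n).numParams := Nat.cast_pos.2 (L n).numParams_pos
  have hr : 0 < r n := hp0.trans hp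
  have hδn : signal D β T n ≤ n := signal_le n
  rw [inv_mul_eq_div, lt_div_iff₀ (by positivity)] at h2 h3
  rw [abs_lt] at hE
  -- Here 16W < 4σ²r < δ. As r < n, the residual is at least nσ²/2 - nσ²/4 = nσ²/4, while the
  -- squared length of `e` is below 3nσ²/2 ≤ 2σ²n.
  refine ⟨by positivity, by positivity, hr.trans h1, hδn, ?_, ?_, ?_, hW, ?_, ?_, ?_⟩
  · rw [ofReal_signal]
    exact min_le_right _ _
  · exact_mod_cast hp.trans (h1.trans_le hδn)
  · linarith
  · nlinarith
  · nlinarith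
  · rw [lt_div_iff₀ (by positivity)]
    refine lt_of_le_of_lt ?_ h3
    have hKn : ((T n).size : ℝ) ≤ K + 1 := by
      have : ((T n).size : ℝ) ≤ K := by exact_mod_cast hK n
      linarith
    rw [mul_assoc]
    gcongr

/-- A wrong selection forces a large projection, bounded by Markov's inequality, or an atypical
length, bounded by Chebyshev's. -/
theorem eventually_measure_ne_le (h : Setting P L D β T σ ε r That) :
    ∀ᶠ n in atTop, P n {ω | That n ω ≠ T n} ≤
      4 * (((L n).numParams : ℝ≥0∞) / ENNReal.ofReal (r n)) +
      ENNReal.ofReal (4 * Var[fun x => x ^ 2; gaussianReal 0 (σ ^ 2).toNNReal] / σ ^ 4 / n) := by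
  have hσ : 0 < σ ^ 2 := pow_pos h.sigma_pos 2
  filter_upwards [h.eventually_recovers, h.full_rank, h.eventually_penalty_pos,
    eventually_gt_atTop 0] with n hrec hrank hr hn
  have hX := mulVec_injective_of_rank hrank
  have hv : ((σ ^ 2).toNNReal : ℝ) = σ ^ 2 := Real.coe_toNNReal _ hσ.le
  have hn' : (0 : ℝ) < n := Nat.cast_pos.2 hn
  let B₁ : Set (Fin n → ℝ) := {e | σ ^ 2 / 4 * r n ≤ projSq (D n) e}
  let B₂ : Set (Fin n → ℝ) := {e | n * σ ^ 2 / 2 ≤ |e ⬝ᵥ e - n * (σ ^ 2).toNNReal|}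
  have hB₁ : MeasurableSet B₁ := measurableSet_le measurable_const measurable_projSq
  have hB₂ : MeasurableSet B₂ := by
    refine measurableSet_le measurable_const ?_
    simp only [dotProduct]
    fun_prop
  have hsub : {ω | That n ω ≠ T n} ⊆ {ω | ε n ω ∈ B₁} ∪ {ω | ε n ω ∈ B₂} := by
    intro ω hω
    by_contra hcon
    simp only [B₁, B₂, hv, Set.mem_union, Set.mem_ofPred_eq, not_or, not_le] at hcon
    exact hω ((hrec _ hcon.1 hcon.2).eq_of_isOutput hX (h.true_model n) (h.selected n ω))
  refine (measure_mono hsub).trans ((measure_union_le _ _).trans (add_le_add ?_ ?_))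
  · rw [(h.errors n).measure_eq (p := fun e => e ∈ B₁) hB₁]
    refine (measure_projSq_le hX (by positivity)).trans (le_of_eq ?_)
    rw [hv, ← ENNReal.ofReal_natCast, ← ENNReal.ofReal_div_of_pos hr,
      ← ENNReal.ofReal_ofNat 4, ← ENNReal.ofReal_mul (by norm_num)]
    congr 1
    have hσ0 : σ ≠ 0 := h.sigma_pos.ne'
    field_simp
  · rw [(h.errors n).measure_eq (p := fun e => e ∈ B₂) hB₂]
    refine (measure_dotProduct_self_le (by positivity)).trans (le_of_eq ?_)
    congr 1
    field_simp
    norm_num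

theorem tendsto_measure_ne (h : Setting P L D β T σ ε r That) :
    Tendsto (fun n => P n {ω | That n ω ≠ T n}) atTop (𝓝 0) := by
  refine tendsto_of_tendsto_of_tendsto_of_le_of_le' tendsto_const_nhds ?_
    (Eventually.of_forall fun _ => zero_le) h.eventually_measure_ne_le
  have h1 := ENNReal.Tendsto.const_mul (a := 4) h.params_prec (Or.inr (by simp))
  have h2 := ENNReal.tendsto_ofReal (tendsto_const_div_atTop_nhds_zero_nat
    (4 * Var[fun x => x ^ 2; gaussianReal 0 (σ ^ 2).toNNReal] / σ ^ 4))
  simpa using h1.add h2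

theorem tendsto_measure_eq [∀ n, IsProbabilityMeasure (P n)] (h : Setting P L D β T σ ε r That) :
    Tendsto (fun n => P n {ω | That n ω = T n}) atTop (𝓝 1) := by
  have heq : ∀ n, P n {ω | That n ω = T n} = 1 - P n {ω | That n ω ≠ T n} := by
    intro n
    have := prob_compl_eq_one_sub (μ := P n) (h.measurable_selected n (T n)).compl
    rwa [compl_compl] at this
  simp_rw [heq]
  simpa using ENNReal.Tendsto.sub tendsto_const_nhds h.tendsto_measure_ne (Or.inl ENNReal.one_ne_top)

end Setting

end Consistency

/-! ### Asymptotic normality -/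

section LimitCov

variable {L : Layout} {M : Model L}

theorem Model.posDef_compress {S : Matrix L.Param L.Param ℝ} (hS : S.PosDef) :
    (M.A1ᵀ * S * M.A1).PosDef := by
  have := hS.conjTranspose_mul_mul_same (B := M.A1) M.A1_mulVec_injective
  rwa [Matrix.conjTranspose_eq_transpose_of_trivial] at this

theorem Model.posSemidef_limitCov {S : Matrix L.Param L.Param ℝ} (hS : S.PosDef) :
    (M.limitCov S).PosSemidef := by
  have := (Model.posDef_compress (M := M) hS).inv.posSemidef.mul_mul_conjTranspose_same M.A1
  rwa [Matrix.conjTranspose_eq_transpose_of_trivial] at this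

/-- The inverse is the adjugate divided by the determinant, both continuous; only the limit has to
be invertible. -/
theorem tendsto_matrix_inv {ι : Type*} [Fintype ι] [DecidableEq ι] {A : ℕ → Matrix ι ι ℝ}
    {B : Matrix ι ι ℝ} (h : Tendsto A atTop (𝓝 B)) (hB : B.det ≠ 0) :
    Tendsto (fun n => (A n)⁻¹) atTop (𝓝 B⁻¹) := by
  simp only [Matrix.inv_def, Ring.inverse_eq_inv']
  have hdet : Tendsto (fun n => (A n).det) atTop (𝓝 B.det) :=
    ((continuous_id.matrix_det).tendsto B).comp h
  have hadj : Tendsto (fun n => (A n).adjugate) atTop (𝓝 B.adjugate) :=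
    ((continuous_id.matrix_adjugate).tendsto B).comp h
  exact (hdet.inv₀ hB).smul hadj

theorem Model.tendsto_limitCov {A : ℕ → Matrix L.Param L.Param ℝ} {S : Matrix L.Param L.Param ℝ}
    (h : Tendsto A atTop (𝓝 S)) (hS : S.PosDef) :
    Tendsto (fun n => M.limitCov (A n)) atTop (𝓝 (M.limitCov S)) := by
  have h1 : Tendsto (fun n => M.A1ᵀ * A n * M.A1) atTop (𝓝 (M.A1ᵀ * S * M.A1)) := by
    have hc : Continuous fun B : Matrix L.Param L.Param ℝ => M.A1ᵀ * B * M.A1 := by fun_prop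
    exact (hc.tendsto S).comp h
  have h2 := tendsto_matrix_inv h1 (Model.posDef_compress (M := M) hS).det_pos.ne'
  have hc : Continuous fun B : Matrix M.Free M.Free ℝ => M.A1 * B * M.A1ᵀ := by fun_prop
  exact (hc.tendsto _).comp h2

end LimitCov

section LinearImage

/-- The characteristic function of a linear image of a vector of independent centered Gaussian
variables. -/
theorem integral_exp_mulVec {ι : Type*} [Fintype ι] {n : ℕ} {v : ℝ≥0} (B : Matrix ι (Fin n) ℝ)
    (t : ι → ℝ) :
    ∫ e, Complex.exp (((t ⬝ᵥ (B *ᵥ e) : ℝ) : ℂ) * Complex.I)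
        ∂(Measure.pi fun _ : Fin n => gaussianReal 0 v) =
      Complex.exp (((-(v * (t ⬝ᵥ ((B * Bᵀ) *ᵥ t)) / 2) : ℝ) : ℂ)) := by
  set u : Fin n → ℝ := Bᵀ *ᵥ t with hu
  have h1 : ∀ e, t ⬝ᵥ (B *ᵥ e) = u ⬝ᵥ e := by
    intro e
    rw [Matrix.dotProduct_mulVec, ← Matrix.mulVec_transpose]
  have h2 : t ⬝ᵥ ((B * Bᵀ) *ᵥ t) = u ⬝ᵥ u := by
    rw [← Matrix.mulVec_mulVec, h1]
  have h3 := charFun_pi (μ := fun _ : Fin n => gaussianReal 0 v) (WithLp.toLp 2 u)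
  rw [charFun_apply, integral_map (by fun_prop)
    (Measurable.aestronglyMeasurable (by fun_prop))] at h3
  simp_rw [h1, h2]
  have h4 : ∀ e : Fin n → ℝ, inner ℝ (WithLp.toLp 2 e) (WithLp.toLp 2 u) = u ⬝ᵥ e := by
    intro e
    simp [PiLp.inner_apply, dotProduct]
  simp_rw [h4] at h3
  rw [h3]
  simp_rw [charFun_gaussianReal, ← Complex.exp_sum]
  congr 1
  simp only [dotProduct]
  push_cast
  rw [Finset.mul_sum, Finset.sum_div, ← Finset.sum_neg_distrib]
  exact Finset.sum_congr rfl fun i _ => by ring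

end LinearImage

section Estimator

variable {L : Layout} {n : ℕ} {D : Data L n}

theorem continuous_betaHat (M : Model L) : Continuous fun y => betaHat D y M :=
  continuous_const.matrix_mulVec (continuous_const.matrix_mulVec
    (continuous_const.matrix_mulVec continuous_id))

/-- The matrix that maps the error vector to the scaled estimation error in the model `T`. -/
noncomputable def errorMap (D : Data L n) (T : Model L) : Matrix L.Param (Fin n) ℝ :=
  Real.sqrt n • (T.A1 * ((Z1 D T)ᵀ * Z1 D T)⁻¹ * (Z1 D T)ᵀ)

theorem sqrt_smul_betaHat_sub (hX : Function.Injective D.X.mulVec) {T : Model L}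
    {β : L.Param → ℝ} (hβ : β ∈ T.space) (e : Fin n → ℝ) :
    Real.sqrt n • (betaHat D (D.X *ᵥ β + e) T - β) = errorMap D T *ᵥ e := by
  obtain ⟨u, rfl⟩ := T.exists_A1_mulVec_eq hβ
  rw [betaHat_eq, lsq_add, ← Z1_mulVec, lsq_mulVec (Z1_mulVec_injective hX T), Matrix.mulVec_add,
    add_sub_cancel_left, errorMap, Matrix.smul_mulVec, lsq, Matrix.mulVec_mulVec,
    Matrix.mulVec_mulVec]

/-- Up to σ², this is the exact covariance of the scaled error at sample size `n`. -/
theorem errorMap_mul_transpose (hX : Function.Injective D.X.mulVec) (hn : n ≠ 0) (T : Model L) :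
    errorMap D T * (errorMap D T)ᵀ = T.limitCov ((n : ℝ)⁻¹ • (D.Xᵀ * D.X)) := by
  have hn' : (n : ℝ) ≠ 0 := Nat.cast_ne_zero.2 hn
  have hdet := isUnit_det_gram (Z1_mulVec_injective hX T)
  have hgram : T.A1ᵀ * ((n : ℝ)⁻¹ • (D.Xᵀ * D.X)) * T.A1 = (n : ℝ)⁻¹ • ((Z1 D T)ᵀ * Z1 D T) := by
    simp only [Z1, Matrix.transpose_mul, Matrix.mul_smul, Matrix.smul_mul, Matrix.mul_assoc]
  have hinv : ((n : ℝ)⁻¹ • ((Z1 D T)ᵀ * Z1 D T))⁻¹ = (n : ℝ) • ((Z1 D T)ᵀ * Z1 D T)⁻¹ := by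
    refine Matrix.inv_eq_right_inv ?_
    rw [Matrix.smul_mul, Matrix.mul_smul, smul_smul, inv_mul_cancel₀ hn', one_smul,
      Matrix.mul_nonsing_inv _ hdet]
  have hsymm : (((Z1 D T)ᵀ * Z1 D T)⁻¹)ᵀ = ((Z1 D T)ᵀ * Z1 D T)⁻¹ := by
    rw [Matrix.transpose_nonsing_inv, Matrix.transpose_mul, Matrix.transpose_transpose]
  rw [Model.limitCov, hgram, hinv, errorMap, Matrix.transpose_smul, Matrix.smul_mul,
    Matrix.mul_smul, smul_smul, Real.mul_self_sqrt (Nat.cast_nonneg n), Matrix.transpose_mul,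
    Matrix.transpose_mul, Matrix.transpose_transpose, hsymm, Matrix.mul_smul, Matrix.smul_mul]
  congr 1
  calc _ = T.A1 * (((Z1 D T)ᵀ * Z1 D T)⁻¹ * ((Z1 D T)ᵀ * Z1 D T)) *
        (((Z1 D T)ᵀ * Z1 D T)⁻¹ * T.A1ᵀ) := by simp only [Matrix.mul_assoc]
    _ = _ := by rw [Matrix.nonsing_inv_mul _ hdet, Matrix.mul_one, Matrix.mul_assoc]

end Estimator

section Selected

/-- With the discrete σ-algebra on the countable index set, measurability can be checked for each
index separately. It is applied to the finite set of models. -/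
theorem aemeasurable_select {Ω ι E G : Type*} [MeasurableSpace Ω] [MeasurableSpace E]
    [MeasurableSpace G] [Countable ι] {P : Measure Ω} {s : Ω → ι} {F : ι → E → G} {X : Ω → E}
    (hs : ∀ i, MeasurableSet {ω | s ω = i}) (hF : ∀ i, Measurable (F i)) (hX : AEMeasurable X P) :
    AEMeasurable (fun ω => F (s ω) (X ω)) P := by
  let _ : MeasurableSpace ι := ⊤
  have hs' : Measurable s := measurable_to_countable' hs
  have hF' : Measurable fun q : ι × E => F q.1 q.2 := measurable_from_prod_countable_right hF
  exact hF'.comp_aemeasurable (hs'.aemeasurable.prodMk hX)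

variable {Ω : ℕ → Type*} [∀ n, MeasurableSpace (Ω n)] {P : ∀ n, Measure (Ω n)}
  {L : Layout} {D : ∀ n, Data L n} {β : ℕ → L.Param → ℝ} {T : Model L}
  {σ : ℝ} {ε : ∀ n, Ω n → Fin n → ℝ} {r : ℕ → ℝ} {That : ∀ n, Ω n → Model L}

/-- The scaled estimation error in the selected model. -/
noncomputable def scaledError (D : ∀ n, Data L n) (β : ℕ → L.Param → ℝ)
    (ε : ∀ n, Ω n → Fin n → ℝ) (That : ∀ n, Ω n → Model L) (n : ℕ) (ω : Ω n) :
    EuclideanSpace ℝ L.Param :=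
  WithLp.toLp 2 (Real.sqrt n • (betaHat (D n) ((D n).X *ᵥ β n + ε n ω) (That n ω) - β n))

namespace Setting

theorem aemeasurable_scaledError
    (h : Setting P (fun _ => L) D β (fun _ => T) σ ε r That) (n : ℕ) :
    AEMeasurable (scaledError D β ε That n) (P n) := by
  refine aemeasurable_select (F := fun M e => (WithLp.toLp 2 (Real.sqrt n •
      (betaHat (D n) ((D n).X *ᵥ β n + e) M - β n)) : EuclideanSpace ℝ L.Param))
    (h.measurable_selected n) (fun M => ?_) (h.errors n).aemeasurable
  refine (WithLp.measurable_toLp 2 _).comp (Continuous.measurable ?_)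
  have hc : Continuous fun e => betaHat (D n) ((D n).X *ᵥ β n + e) M :=
    (continuous_betaHat M).comp (continuous_const.add continuous_id)
  exact (hc.sub continuous_const).const_smul (Real.sqrt n)

variable [∀ n, IsProbabilityMeasure (P n)]

/-- The characteristic functions of the estimation errors in the selected and in the true
model differ by at most twice the probability of a wrong selection. -/
theorem norm_charFun_sub_le (h : Setting P (fun _ => L) D β (fun _ => T) σ ε r That) {n : ℕ}
    (hX : Function.Injective (D n).X.mulVec) (hn : n ≠ 0) (t : EuclideanSpace ℝ L.Param) :
    ‖charFun ((P n).map (scaledError D β ε That n)) t -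
        Complex.exp (((-(σ ^ 2 * (t ⬝ᵥ (T.limitCov ((n : ℝ)⁻¹ • ((D n).Xᵀ * (D n).X)) *ᵥ t)) / 2)
          : ℝ) : ℂ))‖ ≤ 2 * (P n).real {ω | That n ω ≠ T} := by
  have hmeas := h.aemeasurable_scaledError n
  have hv : ((σ ^ 2).toNNReal : ℝ) = σ ^ 2 := Real.coe_toNNReal _ (sq_nonneg σ)
  have hU := integral_exp_mulVec (v := (σ ^ 2).toNNReal) (errorMap (D n) T) t.ofLp
  rw [hv, errorMap_mul_transpose hX hn, ← (h.errors n).integral_comp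
    (Continuous.aestronglyMeasurable (by simp only [dotProduct]; fun_prop))] at hU
  rw [← hU, charFun_apply, integral_map hmeas
    (Measurable.aestronglyMeasurable (by fun_prop))]
  have hε := (h.errors n).aemeasurable
  have hnorm : ∀ x : ℝ, ‖Complex.exp ((x : ℂ) * Complex.I)‖ = 1 := Complex.norm_exp_ofReal_mul_I
  have hint1 : Integrable (fun ω => Complex.exp
      ((inner ℝ (scaledError D β ε That n ω) t : ℝ) * Complex.I)) (P n) := by
    refine Integrable.of_bound ?_ 1 (Eventually.of_forall fun ω => (hnorm _).le)
    have hF : Measurable fun x : EuclideanSpace ℝ L.Param =>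
      Complex.exp ((inner ℝ x t : ℝ) * Complex.I) := by fun_prop
    exact (hF.comp_aemeasurable hmeas).aestronglyMeasurable
  have hint2 : Integrable ((fun e => Complex.exp
      (((t.ofLp ⬝ᵥ (errorMap (D n) T *ᵥ e) : ℝ) : ℂ) * Complex.I)) ∘ ε n) (P n) := by
    refine Integrable.of_bound ?_ 1 (Eventually.of_forall fun ω => (hnorm _).le)
    have hF : Continuous fun e : Fin n → ℝ =>
      Complex.exp (((t.ofLp ⬝ᵥ (errorMap (D n) T *ᵥ e) : ℝ) : ℂ) * Complex.I) := by
      simp only [dotProduct]; fun_prop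
    exact (hF.measurable.comp_aemeasurable hε).aestronglyMeasurable
  rw [← integral_sub hint1 hint2]
  have hset : MeasurableSet {ω | That n ω ≠ T} := (h.measurable_selected n T).compl
  -- The two exponentials agree where the selection is right, and elsewhere both have modulus 1.
  have hbound : ∀ ω, ‖Complex.exp ((inner ℝ (scaledError D β ε That n ω) t : ℝ) * Complex.I) -
      ((fun e => Complex.exp (((t.ofLp ⬝ᵥ (errorMap (D n) T *ᵥ e) : ℝ) : ℂ) * Complex.I)) ∘ ε n) ω‖
      ≤ {ω | That n ω ≠ T}.indicator (fun _ => (2 : ℝ)) ω := by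
    intro ω
    by_cases hω : That n ω = T
    · rw [Set.indicator_of_notMem (by simpa using hω)]
      have heq : inner ℝ (scaledError D β ε That n ω) t =
          t.ofLp ⬝ᵥ (errorMap (D n) T *ᵥ ε n ω) := by
        rw [← sqrt_smul_betaHat_sub hX (h.true_model n).1, scaledError, hω]
        simp [PiLp.inner_apply, dotProduct]
      rw [Function.comp_apply, heq, sub_self, norm_zero]
    · rw [Set.indicator_of_mem (by exact hω)]
      refine (norm_sub_le _ _).trans ?_
      rw [Function.comp_apply, hnorm, hnorm]
      norm_num
  calc _ ≤ ∫ ω, {ω | That n ω ≠ T}.indicator (fun _ => (2 : ℝ)) ω ∂(P n) :=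
        norm_integral_le_of_norm_le ((integrable_const _).indicator hset)
          (Eventually.of_forall hbound)
    _ = 2 * (P n).real {ω | That n ω ≠ T} := by
        rw [integral_indicator_const _ hset, smul_eq_mul, mul_comm]

theorem tendstoInDistribution_scaledError {S : Matrix L.Param L.Param ℝ}
    (h : Setting P (fun _ => L) D β (fun _ => T) σ ε r That) (hS : S.PosDef)
    (hXX : Tendsto (fun n : ℕ => (n : ℝ)⁻¹ • ((D n).Xᵀ * (D n).X)) atTop (𝓝 S)) :
    TendstoInDistribution (scaledError D β ε That) atTop id P
      (multivariateGaussian 0 (σ ^ 2 • T.limitCov S)) where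
  forall_aemeasurable := h.aemeasurable_scaledError
  aemeasurable_limit := aemeasurable_id
  tendsto := by
    -- Lévy's continuity theorem reduces the claim to pointwise convergence of characteristic
    -- functions.
    refine ProbabilityMeasure.tendsto_iff_tendsto_charFun.2 fun t => ?_
    have hpsd : (σ ^ 2 • T.limitCov S).PosSemidef :=
      (Model.posSemidef_limitCov hS).smul (sq_nonneg σ)
    have hlim : Tendsto (fun n : ℕ => Complex.exp (((-(σ ^ 2 * (t ⬝ᵥ
        (T.limitCov ((n : ℝ)⁻¹ • ((D n).Xᵀ * (D n).X)) *ᵥ t)) / 2) : ℝ) : ℂ))) atTop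
        (𝓝 (charFun (multivariateGaussian 0 (σ ^ 2 • T.limitCov S)) t)) := by
      have hc : Continuous fun B : Matrix L.Param L.Param ℝ =>
          Complex.exp (((-(σ ^ 2 * (t.ofLp ⬝ᵥ (B *ᵥ t.ofLp)) / 2) : ℝ) : ℂ)) := by
        simp only [dotProduct]
        fun_prop
      have := (hc.tendsto (T.limitCov S)).comp (Model.tendsto_limitCov (M := T) hXX hS)
      have heq : charFun (multivariateGaussian 0 (σ ^ 2 • T.limitCov S)) t =
          Complex.exp (((-(σ ^ 2 * (t.ofLp ⬝ᵥ (T.limitCov S *ᵥ t.ofLp)) / 2) : ℝ) : ℂ)) := by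
        rw [charFun_multivariateGaussian hpsd]
        congr 1
        simp [Matrix.smul_mulVec, dotProduct_smul]
      rw [heq]
      exact this
    have hne : Tendsto (fun n => 2 * (P n).real {ω | That n ω ≠ T}) atTop (𝓝 0) := by
      have := (ENNReal.tendsto_toReal ENNReal.zero_ne_top).comp h.tendsto_measure_ne
      simpa [Measure.real] using this.const_mul 2
    have hdiff : Tendsto (fun n => charFun ((P n).map (scaledError D β ε That n)) t -
        Complex.exp (((-(σ ^ 2 * (t ⬝ᵥ (T.limitCov ((n : ℝ)⁻¹ • ((D n).Xᵀ * (D n).X)) *ᵥ t)) / 2)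
          : ℝ) : ℂ))) atTop (𝓝 0) := by
      refine squeeze_zero_norm' ?_ hne
      filter_upwards [h.full_rank, eventually_ne_atTop 0] with n hrank hn
      exact h.norm_charFun_sub_le (mulVec_injective_of_rank hrank) hn t
    have hsum := hdiff.add hlim
    simp only [sub_add_cancel, zero_add] at hsum
    simpa only [ProbabilityMeasure.coe_mk, Measure.map_id] using hsum

end Setting

end Selected

end DMR

/-- (a) The selected model is the true model with probability tending to one. (b) If moreover the
layout (hence `p`) and the true model do not depend on `n` and `Xᵀ X / n` converges to a positive
definite `S`, then the estimator in the selected model is asymptotically normal. -/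
theorem theorem1 {Ω : ℕ → Type*} [∀ n, MeasurableSpace (Ω n)] (P : ∀ n, Measure (Ω n))
    [∀ n, IsProbabilityMeasure (P n)] (σ : ℝ) (ε : ∀ n, Ω n → Fin n → ℝ) (r : ℕ → ℝ) :
    (∀ (L : ℕ → DMR.Layout) (D : ∀ n, DMR.Data (L n) n) (β : ∀ n, (L n).Param → ℝ)
      (T : ∀ n, DMR.Model (L n)) (That : ∀ n, Ω n → DMR.Model (L n)),
      DMR.Setting P L D β T σ ε r That →
      Tendsto (fun n => P n {ω | That n ω = T n}) atTop (𝓝 1)) ∧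
    (∀ (L : DMR.Layout) (D : ∀ n, DMR.Data L n) (β : ℕ → L.Param → ℝ) (T : DMR.Model L)
      (That : ∀ n, Ω n → DMR.Model L) (S : Matrix L.Param L.Param ℝ),
      DMR.Setting P (fun _ => L) D β (fun _ => T) σ ε r That →
      S.PosDef →
      Tendsto (fun n : ℕ => (n : ℝ)⁻¹ • ((D n).Xᵀ * (D n).X)) atTop (𝓝 S) →
      TendstoInDistribution
        (fun (n : ℕ) ω => WithLp.toLp 2 (Real.sqrt n •
          (DMR.betaHat (D n) ((D n).X *ᵥ β n + ε n ω) (That n ω) - β n)))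
        atTop id P (multivariateGaussian 0 (σ ^ 2 • T.limitCov S))) :=
  ⟨fun _ _ _ _ _ h => h.tendsto_measure_eq,
    fun _ _ _ _ _ _ h hS hXX => h.tendstoInDistribution_scaledError hS hXX⟩
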